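/- Let $\mathcal N$ be the class of functions holomorphic in the open upper half-plane $\mathbb C_+$ with values in the closed upper half-plane (i.e. the holomorphic maps $\mathbb C_+\to\mathbb C_+$ together with the real constants). For an integer $\varkappa\ge 0$, let $\mathcal N_\varkappa$ be the class of functions $\varphi$ meromorphic in $\mathbb C_+$, extended to the lower half-plane by $\varphi(\overline z)=\overline{\varphi(z)}$, such that for every finite system $z_1,\dots,z_k$ of non-real points of holomorphy of $\varphi$ the Hermitian form $$\sum_{n,m=1}^k \frac{\varphi(z_m)-\overline{\varphi(z_n)}}{z_m-\overline{z_n}}\,\xi_m\overline{\xi_n}$$ (the quotient being $\varphi'(z_m)$ if $z_m=\overline{z_n}$) has at most $\varkappa$ negative squares, and for some such system of distinct points it has exactly $\varkappa$ negative squares. Let $\mathcal N_\varkappa^+$ be the class of those $\varphi\in\mathcal N_\varkappa$ for which $z\varphi(z)$ belongs to $\mathcal N$. Theorem. Let $\Phi\in\mathcal N$, let $\varphi(z)=\Phi(z)/z$, and let $\varkappa\ge0$ be an integer. Then $\varphi\in\mathcal N_\varkappa$ (equivalently, $\varphi\in\mathcal N_\varkappa^+$) if and only if $\Phi$ has one of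 the following two forms on $\mathbb C_+$. (1) $\varkappa\ge1$ and $$\Phi(z)=bz+a+\sum_{n=1}^{\varkappa-1}\frac{\sigma_n}{\lambda_n-z}+\int_{[0,\infty)}\left(\frac1{t-z}-\frac t{1+t^2}\right)d\sigma(t),$$ $$0<\Phi(0-)=a+\sum_{n=1}^{\varkappa-1}\frac{\sigma_n}{\lambda_n}+\int_{[0,\infty)}\frac{d\sigma(t)}{t+t^3}\le\infty;$$ (2) $$\Phi(z)=bz+a+\sum_{n=1}^{\varkappa}\frac{\sigma_n}{\lambda_n-z}+\int_{[0,\infty)}\left(\frac1{t-z}-\frac t{1+t^2}\right)d\sigma(t),$$ $$\Phi(0-)=a+\sum_{n=1}^{\varkappa}\frac{\sigma_n}{\lambda_n}+\int_{[0,\infty)}\frac{d\sigma(t)}{t+t^3}\le0.$$ Here $b\ge0$, $a\in\mathbb R$, the $\lambda_n<0$ are distinct, $\sigma_n>0$, and $\sigma$ is a Borel measure on $[0,\infty)$ with $\int_{[0,\infty)}\frac{d\sigma(t)}{1+t^2}<\infty$; the integrand $1/(t+t^3)$ is $+\infty$ at $t=0$. Moreover, whenever $\Phi$ is given by a formula as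 in (1) or (2) with any finite number of poles $\lambda_n$ (and no condition on the sign), it has real boundary values on $(-\varepsilon,0)$ for some $\varepsilon>0$, and their limit $\Phi(0-)\in(-\infty,\infty]$ as $x\to0-$ exists and is equal to the stated expression. -/

import Mathlib

open MeasureTheory Filter Topology
open scoped ComplexConjugate Matrix

noncomputable section

/-- The open upper half-plane `ℂ₊`. -/
def upperHP : Set ℂ := {z : ℂ | 0 < z.im}

/-- The Nevanlinna class `𝒩`: functions holomorphic in `ℂ₊` with values in the closed upper
half-plane. By the open mapping theorem, these are the holomorphic maps `ℂ₊ → ℂ₊` together with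
the real constants. Only the values on `ℂ₊` matter. -/
def IsNevanlinna (Φ : ℂ → ℂ) : Prop :=
  DifferentiableOn ℂ Φ upperHP ∧ ∀ z ∈ upperHP, 0 ≤ (Φ z).im

/-- The number of negative squares of the Hermitian form `ξ ↦ ξᴴ H ξ`, that is, the greatest
dimension of a subspace on which the form is negative definite. -/
def negSquares {k : ℕ} (H : Matrix (Fin k) (Fin k) ℂ) : ℕ :=
  sSup {d : ℕ | ∃ V : Submodule ℂ (Fin k → ℂ), Module.finrank ℂ V = d ∧
    ∀ ξ ∈ V, ξ ≠ 0 → (star ξ ⬝ᵥ (H *ᵥ ξ)).re < 0}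

/-- The supremum in the definition of `negSquares` is attained. -/
theorem negSquares_isGreatest {k : ℕ} (H : Matrix (Fin k) (Fin k) ℂ) :
    IsGreatest {d : ℕ | ∃ V : Submodule ℂ (Fin k → ℂ), Module.finrank ℂ V = d ∧
      ∀ ξ ∈ V, ξ ≠ 0 → (star ξ ⬝ᵥ (H *ᵥ ξ)).re < 0} (negSquares H) := by
  have hb : BddAbove {d : ℕ | ∃ V : Submodule ℂ (Fin k → ℂ), Module.finrank ℂ V = d ∧
      ∀ ξ ∈ V, ξ ≠ 0 → (star ξ ⬝ᵥ (H *ᵥ ξ)).re < 0} := by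
    refine ⟨Module.finrank ℂ (Fin k → ℂ), ?_⟩
    rintro _ ⟨V, rfl, -⟩
    exact V.finrank_le
  refine ⟨Nat.sSup_mem ⟨0, ⊥, finrank_bot ℂ _, ?_⟩ hb, fun d hd => le_csSup hb hd⟩
  intro ξ hξ h0
  exact absurd ((Submodule.mem_bot ℂ).1 hξ) h0

/-- The extension of a function from `ℂ₊` to the lower half-plane by
`φ (conj z) = conj (φ z)`. -/
def symmExt (φ : ℂ → ℂ) (z : ℂ) : ℂ :=
  if 0 < z.im then φ z else conj (φ (conj z))

/-- The kernel `(φ(z) - conj φ(w)) / (z - conj w)` for non-real `z`, `w`, where `φ` is extended to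
the lower half-plane by symmetry. On the diagonal `z = conj w` it takes its value by continuity,
the derivative `φ'(z)`. -/
def pickKernel (φ : ℂ → ℂ) (z w : ℂ) : ℂ :=
  if z = conj w then deriv (symmExt φ) z
  else (symmExt φ z - conj (symmExt φ w)) / (z - conj w)

/-- The matrix of the Hermitian form
`h(ξ | z) = ∑ n, m, (φ(z_m) - conj φ(z_n)) / (z_m - conj z_n) * ξ_m * conj ξ_n`. -/
def pickMatrix (φ : ℂ → ℂ) {k : ℕ} (z : Fin k → ℂ) : Matrix (Fin k) (Fin k) ℂ :=
  Matrix.of fun n m => pickKernel φ (z m) (z n)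

/-- `z` is a finite system of non-real points at which (the symmetric extension of) `φ` is
holomorphic. -/
def IsAdmissible (φ : ℂ → ℂ) {k : ℕ} (z : Fin k → ℂ) : Prop :=
  ∀ j, (z j).im ≠ 0 ∧ AnalyticAt ℂ (symmExt φ) (z j)

/-- The generalized Nevanlinna class `𝒩_κ`: functions meromorphic in `ℂ₊` such that each form
`h(ξ | z)` has at most `κ` negative squares and some form has exactly `κ` negative squares. -/
def IsGenNevanlinna (κ : ℕ) (φ : ℂ → ℂ) : Prop :=
  MeromorphicOn φ upperHP ∧
  (∀ (k : ℕ) (z : Fin k → ℂ), IsAdmissible φ z → negSquares (pickMatrix φ z) ≤ κ) ∧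
  (∃ (k : ℕ) (z : Fin k → ℂ), Function.Injective z ∧ IsAdmissible φ z ∧
    negSquares (pickMatrix φ z) = κ)

/-- The class `𝒩_κ⁺`: the functions `φ` of the class `𝒩_κ` such that `z φ(z)` belongs to `𝒩`. -/
def IsGenNevanlinnaPlus (κ : ℕ) (φ : ℂ → ℂ) : Prop :=
  IsGenNevanlinna κ φ ∧ IsNevanlinna fun z => z * φ z

/-- The data of a representation
`b z + a + ∑ j, s_j / (p_j - z) + ∫_[0,∞) (1 / (t - z) - t / (1 + t ^ 2)) dσ(t)`
with exactly `n` distinct negative poles `p_j`, masses `s_j > 0`, `b ≥ 0`, `a` real, and a measure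
`σ` on `[0, ∞)` with `∫_[0,∞) dσ(t) / (1 + t ^ 2) < ∞`. -/
structure PoleRep (n : ℕ) where
  b : ℝ
  a : ℝ
  pole : Fin n → ℝ
  mass : Fin n → ℝ
  σ : Measure ℝ
  b_nonneg : 0 ≤ b
  pole_neg : ∀ j, pole j < 0
  pole_injective : Function.Injective pole
  mass_pos : ∀ j, 0 < mass j
  σ_neg : σ (Set.Iio 0) = 0
  σ_integrable : IntegrableOn (fun t : ℝ => 1 / (1 + t ^ 2)) (Set.Ici 0) σ

/-- The function given by a representation. -/
def PoleRep.toFun {n : ℕ} (D : PoleRep n) (z : ℂ) : ℂ :=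
  (D.b : ℂ) * z + (D.a : ℂ) + ∑ j, (D.mass j : ℂ) / ((D.pole j : ℂ) - z) +
    ∫ t in Set.Ici (0 : ℝ), (1 / ((t : ℂ) - z) - (t : ℂ) / (1 + (t : ℂ) ^ 2)) ∂D.σ

/-- The number `a + ∑ j, s_j / p_j + ∫_[0,∞) dσ(t) / (t + t ^ 3)`, which lies in `(-∞, ∞]`. -/
def PoleRep.valueZero {n : ℕ} (D : PoleRep n) : EReal :=
  ((D.a + ∑ j, D.mass j / D.pole j : ℝ) : EReal) +
    ((∫⁻ t in Set.Ici (0 : ℝ), (ENNReal.ofReal (t + t ^ 3))⁻¹ ∂D.σ : ENNReal) : EReal)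

/-- `Φ(0-) = L`: to the left of the origin and close to it, `Φ` has real boundary values `g x` from
`ℂ₊`, and `g x` tends to `L` as `x` tends to `0` from the left. -/
def HasValueZeroMinus (Φ : ℂ → ℂ) (L : EReal) : Prop :=
  ∃ g : ℝ → ℝ,
    (∀ᶠ x : ℝ in 𝓝[<] 0,
      Tendsto (fun y : ℝ => Φ ((x : ℂ) + (y : ℂ) * Complex.I)) (𝓝[>] 0) (𝓝 (g x : ℂ))) ∧
    Tendsto (fun x : ℝ => (g x : EReal)) (𝓝[<] 0) (𝓝 L)

end

/-! By the Nevanlinna representation, Φ(z) = bz + a + ∫ (1/(t-z) - t/(1+t²)) dσ(t) for a measure σ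
on the whole line, and everything is read off from σ and a. The term bz contributes the real
constant b to Φ(z)/z and drops out of the form. After the substitution ξ_m = z_m c_m, the form of
Φ(z)/z becomes the `energy` -a|S|² + ∫ (t|F(t)|² - 2 Re(F(t) conj S) + t|S|²/(1+t²)) dσ(t), where S
= ∑ c_m and F(t) = ∑ c_m/(t - z_m) (`re_pickMatrix_form`). Completing the square
(`energyDensity_eq`) rewrites it, when the integrals converge, as -Φ(0-)|S|² + ∫ t⁻¹|tF(t) - S|²
dσ(t). Hence each point mass on the negative half-line should produce one negative square, and Φ(0-)
> 0 one more.

Upper bounds count linear conditions that force the energy to be nonnegative. With n negative poles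
p_j, the n + 1 conditions S = 0, F(p_j) = 0 always suffice (`negSquares_le_add_one`), and if Φ(0-) ≤
0 the n conditions p_j F(p_j) = S suffice (`negSquares_le_of_value_nonpos`).

Lower bounds exhibit negative subspaces. Pairs of points x ± iε with S = 0 make F a bump at x; since
t|F|² is negative there, N distinct negative points of positive lower density of σ give N negative
squares (`exists_le_negSquares_of_lowerDensity`). For the extra square a single weighted point near
0 is added to bumps at the poles; the limit form at ε = 0 is negative definite, and compactness of
the unit sphere carries this to small ε (`exists_add_one_le_negSquares`).

Conversely, σ-almost every point has positive lower density (`ae_hasPositiveLowerDensity`), so a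
bound on the negative squares leaves only finitely many negative points to carry σ. Thus Φ has a
representation with finitely many poles, and the sign of Φ(0-) together with uniqueness of the index
decides between the two forms. -/

noncomputable section

/-! ### Integral formulas on the unit disc -/

/-- **Schwarz integral formula** on the unit disc. -/
theorem schwarz_integral_formula {g : ℂ → ℂ} (hg : DiffContOnCl ℂ g (Metric.ball 0 1)) {w : ℂ}
    (hw : w ∈ Metric.ball (0 : ℂ) 1) :
    g w = Complex.I * (g 0).im +
      Real.circleAverage (fun e => (e + w) / (e - w) * ((g e).re : ℂ)) 0 1 := by
  have hcl : closure (Metric.ball (0 : ℂ) 1) = Metric.closedBall 0 1 := closure_ball 0 one_ne_zero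
  have hgc : ContinuousOn g (Metric.sphere 0 1) :=
    hg.2.mono (Metric.sphere_subset_closedBall.trans_eq hcl.symm)
  have hne : ∀ e ∈ Metric.sphere (0 : ℂ) 1, e - w ≠ 0 := by
    intro e he h
    rw [sub_eq_zero] at h
    subst h
    simp at he hw
    linarith
  have hw' : ‖w‖ < 1 := by simpa using hw
  have hne2 : ∀ e ∈ Metric.closedBall (0 : ℂ) 1, 1 - conj w * e ≠ 0 := by
    intro e he h
    rw [sub_eq_zero] at h
    have h2 : ‖conj w * e‖ = 1 := by rw [← h]; simp
    rw [norm_mul, RCLike.norm_conj] at h2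
    have h3 : ‖e‖ ≤ 1 := by simpa using he
    nlinarith [norm_nonneg e, norm_nonneg w]
  have h1 : Real.circleAverage (fun e => (e / (e - w)) * g e) 0 1 = g w := by
    have := DiffContOnCl.circleAverage_smul_div (c := 0) (R := 1) (w := w) (f := g)
      (by simpa using hg) (by simpa using hw)
    simpa using this
  -- On the circle conj e = 1/e, so the conjugate of e/(e - w) is (1 - conj w * e)⁻¹, which is
  -- holomorphic in the disc. The mean value property therefore evaluates the average of e/(e - w)
  -- against conj g.
  have h2 : Real.circleAverage (fun e => (1 - conj w * e)⁻¹ * g e) 0 1 = g 0 := by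
    have hd : DiffContOnCl ℂ (fun e => (1 - conj w * e)⁻¹) (Metric.ball 0 1) := by
      apply DifferentiableOn.diffContOnCl
      rw [hcl]
      intro e he
      exact DifferentiableAt.differentiableWithinAt
        (DifferentiableAt.inv (by fun_prop) (hne2 e he))
    have := DiffContOnCl.circleAverage (c := 0) (R := 1) (f := fun e => (1 - conj w * e)⁻¹ • g e)
      (by simpa using hd.smul hg)
    simpa using this
  have h3 : Real.circleAverage (fun e => (e / (e - w)) * conj (g e)) 0 1 = conj (g 0) := by
    rw [← h2]
    have := (Complex.conjCLE.toContinuousLinearMap).circleAverage_comp_comm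
      (f := fun e => (1 - conj w * e)⁻¹ * g e) (c := 0) (R := 1) (by
        apply ContinuousOn.circleIntegrable zero_le_one
        refine ContinuousOn.mul (ContinuousOn.inv₀ (by fun_prop) ?_) hgc
        exact fun e he => hne2 e (Metric.sphere_subset_closedBall he))
    have h4 : Complex.conjCLE.toContinuousLinearMap
        (Real.circleAverage (fun e => (1 - conj w * e)⁻¹ * g e) 0 1) =
          conj (Real.circleAverage (fun e => (1 - conj w * e)⁻¹ * g e) 0 1) := rfl
    rw [← h4, ← this]
    apply Real.circleAverage_congr_sphere
    intro e he
    have he' : e ∈ Metric.sphere (0 : ℂ) 1 := by simpa using he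
    have hee : e * conj e = 1 := by
      rw [Complex.mul_conj, Complex.normSq_eq_norm_sq]
      have : ‖e‖ = 1 := by simpa using he'
      simp [this]
    have he0 : e ≠ 0 := by rintro rfl; simp at hee
    simp only [Function.comp_apply]
    change e / (e - w) * conj (g e) = conj ((1 - conj w * e)⁻¹ * g e)
    rw [map_mul, map_inv₀, map_sub, map_mul, map_one, Complex.conj_conj]
    congr 1
    have hc : conj e = e⁻¹ := eq_inv_of_mul_eq_one_right hee
    rw [hc]
    have := hne e he'
    field_simp
  have hci : ∀ {k : ℂ → ℂ}, ContinuousOn k (Metric.sphere 0 1) → CircleIntegrable k 0 1 :=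
    fun h => ContinuousOn.circleIntegrable zero_le_one h
  have hcc : ContinuousOn (fun e => (e / (e - w))) (Metric.sphere (0 : ℂ) 1) :=
    ContinuousOn.div (by fun_prop) (by fun_prop) hne
  have hconj : ContinuousOn (fun e => conj (g e)) (Metric.sphere (0 : ℂ) 1) :=
    Complex.continuous_conj.comp_continuousOn hgc
  have hre : Real.circleAverage (fun e => ((g e).re : ℂ)) 0 1 = ((g 0).re : ℂ) := by
    have hm : Real.circleAverage g 0 1 = g 0 :=
      DiffContOnCl.circleAverage (c := 0) (R := 1) (f := g) (by simpa using hg)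
    have hmc := (Complex.reCLM).circleAverage_comp_comm (f := g) (c := 0) (R := 1) (hci hgc)
    rw [hm] at hmc
    have := (Complex.ofRealCLM).circleAverage_comp_comm (f := fun e => (g e).re) (c := 0) (R := 1)
      (ContinuousOn.circleIntegrable zero_le_one (Complex.continuous_re.comp_continuousOn hgc))
    calc _ = _ := this
      _ = _ := by
        simpa [Function.comp_def] using hmc
  -- Here (e + w)/(e - w) = 2e/(e - w) - 1 and Re g = (g + conj g)/2, which reduces the average to
  -- the three already computed.
  have hsum : Real.circleAverage (fun e => (e + w) / (e - w) * ((g e).re : ℂ)) 0 1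
      = g w + conj (g 0) - (g 0).re := by
    rw [← h1, ← h3, ← hre, ← Real.circleAverage_fun_add (hci (k := fun e => e / (e - w) * g e) (hcc.mul hgc))
      (hci (k := fun e => e / (e - w) * conj (g e)) (hcc.mul hconj)),
      ← Real.circleAverage_fun_sub]
    · apply Real.circleAverage_congr_sphere
      intro e he
      have := hne e (by simpa using he)
      have hr : ((g e).re : ℂ) = (g e + conj (g e)) / 2 := by
        rw [Complex.add_conj]; push_cast; ring
      simp only
      rw [hr]
      field_simp
      ring
    · exact (hci (hcc.mul hgc)).add (hci (hcc.mul hconj))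
    · exact hci (Complex.continuous_ofReal.comp_continuousOn
        (Complex.continuous_re.comp_continuousOn hgc))
  rw [hsum]
  apply Complex.ext <;> simp

/-- The parametrization of the unit circle by the angle. -/
def circleParam (θ : ℝ) : Metric.sphere (0 : ℂ) 1 :=
  ⟨circleMap 0 1 θ, circleMap_mem_sphere 0 zero_le_one θ⟩

theorem continuous_circleParam : Continuous circleParam :=
  (continuous_circleMap 0 1).subtype_mk _

/-- The positive measure on the unit circle with density `u` with respect to the normalized
arc length. -/
def circleMeasure (u : ℂ → ℝ) : Measure (Metric.sphere (0 : ℂ) 1) :=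
  ((volume.restrict (Set.Ioc 0 (2 * Real.pi))).withDensity
    fun θ => ENNReal.ofReal ((2 * Real.pi)⁻¹ * u (circleMap 0 1 θ))).map circleParam

theorem integral_circleMeasure {u : ℂ → ℝ} (hu : ContinuousOn u (Metric.sphere 0 1))
    (hu0 : ∀ e ∈ Metric.sphere (0 : ℂ) 1, 0 ≤ u e) {k : ℂ → ℂ}
    (hk : ContinuousOn k (Metric.sphere 0 1)) :
    ∫ e : Metric.sphere (0 : ℂ) 1, k e ∂circleMeasure u =
      Real.circleAverage (fun e => k e * (u e : ℂ)) 0 1 := by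
  have hmem : ∀ θ, circleMap 0 1 θ ∈ Metric.sphere (0 : ℂ) 1 := fun θ =>
    circleMap_mem_sphere 0 zero_le_one θ
  have huc : Continuous fun θ => u (circleMap 0 1 θ) :=
    hu.comp_continuous (continuous_circleMap 0 1) hmem
  have hkc : Continuous fun e : Metric.sphere (0 : ℂ) 1 => k e :=
    hk.comp_continuous continuous_subtype_val fun e => e.2
  rw [circleMeasure, integral_map continuous_circleParam.aemeasurable
    hkc.aestronglyMeasurable, integral_withDensity_eq_integral_toReal_smul, Real.circleAverage,
    intervalIntegral.integral_of_le Real.two_pi_pos.le, ← integral_smul]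
  · apply integral_congr_ae
    filter_upwards with θ
    rw [ENNReal.toReal_ofReal (mul_nonneg (by positivity) (hu0 _ (hmem θ)))]
    simp only [Complex.real_smul, circleParam]
    push_cast
    ring
  · exact (huc.const_mul _).measurable.ennreal_ofReal
  · filter_upwards with θ
    exact ENNReal.ofReal_lt_top

theorem isFiniteMeasure_circleMeasure {u : ℂ → ℝ} (hu : ContinuousOn u (Metric.sphere 0 1)) :
    IsFiniteMeasure (circleMeasure u) := by
  have hmem : ∀ θ, circleMap 0 1 θ ∈ Metric.sphere (0 : ℂ) 1 := fun θ =>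
    circleMap_mem_sphere 0 zero_le_one θ
  have huc : Continuous fun θ => (2 * Real.pi)⁻¹ * u (circleMap 0 1 θ) :=
    (hu.comp_continuous (continuous_circleMap 0 1) hmem).const_mul _
  have : IsFiniteMeasure ((volume.restrict (Set.Ioc 0 (2 * Real.pi))).withDensity
    fun θ => ENNReal.ofReal ((2 * Real.pi)⁻¹ * u (circleMap 0 1 θ))) := by
    apply isFiniteMeasure_withDensity_ofReal
    exact (huc.integrableOn_Ioc).2
  unfold circleMeasure
  infer_instance

theorem sub_ne_zero_of_sphere_of_ball {e w : ℂ} (he : e ∈ Metric.sphere (0 : ℂ) 1)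
    (hw : w ∈ Metric.ball (0 : ℂ) 1) : e - w ≠ 0 := by
  intro h
  rw [sub_eq_zero] at h
  subst h
  simp at he hw
  linarith

/-- **Herglotz representation** of a holomorphic function with nonnegative real part on the
unit disc. -/
theorem herglotz_representation {f : ℂ → ℂ} (hf : DifferentiableOn ℂ f (Metric.ball 0 1))
    (hf0 : ∀ w ∈ Metric.ball (0 : ℂ) 1, 0 ≤ (f w).re) :
    ∃ μ : Measure (Metric.sphere (0 : ℂ) 1), IsFiniteMeasure μ ∧ ∀ w ∈ Metric.ball (0 : ℂ) 1,
      f w = Complex.I * (f 0).im + ∫ e : Metric.sphere (0 : ℂ) 1, ((e : ℂ) + w) / (e - w) ∂μ := by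
  let r : ℕ → ℝ := fun n => 1 - 1 / ((n : ℝ) + 1 + 1)
  have hr1 : ∀ n, r n < 1 := fun n => by
    have : (0 : ℝ) < 1 / ((n : ℝ) + 1 + 1) := by positivity
    simp only [r]; linarith
  have hr0 : ∀ n, 0 ≤ r n := fun n => by
    have : 1 / ((n : ℝ) + 1 + 1) ≤ 1 := by
      rw [div_le_one (by positivity)]
      linarith [(Nat.cast_nonneg n : (0 : ℝ) ≤ n)]
    simp only [r]; linarith
  have hrt : Tendsto r atTop (𝓝 1) := by
    have h := tendsto_one_div_add_atTop_nhds_zero_nat (𝕜 := ℝ)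
    have h2 := ((tendsto_add_atTop_iff_nat 1).2 h).const_sub 1
    simpa [r] using h2
  have hmap : ∀ n, ∀ w ∈ Metric.closedBall (0 : ℂ) 1, (r n : ℂ) * w ∈ Metric.ball (0 : ℂ) 1 := by
    intro n w hw
    have hw' : ‖w‖ ≤ 1 := by simpa using hw
    simp only [mem_ball_zero_iff, norm_mul, Complex.norm_real, Real.norm_eq_abs, abs_of_nonneg (hr0 n)]
    nlinarith [hr0 n, hr1 n, norm_nonneg w]
  let g : ℕ → ℂ → ℂ := fun n w => f (r n * w)
  have hgd : ∀ n, DifferentiableOn ℂ (g n) (Metric.closedBall 0 1) := fun n =>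
    hf.comp (by fun_prop) (hmap n)
  have hg : ∀ n, DiffContOnCl ℂ (g n) (Metric.ball 0 1) := fun n => by
    apply DifferentiableOn.diffContOnCl
    rw [closure_ball 0 one_ne_zero]
    exact hgd n
  have hg0 : ∀ n, g n 0 = f 0 := fun n => by simp [g]
  let u : ℕ → ℂ → ℝ := fun n w => (g n w).re
  have huc : ∀ n, ContinuousOn (u n) (Metric.sphere 0 1) := fun n =>
    Complex.continuous_re.comp_continuousOn
      ((hgd n).continuousOn.mono Metric.sphere_subset_closedBall)
  have hu0 : ∀ n, ∀ e ∈ Metric.sphere (0 : ℂ) 1, 0 ≤ u n e := fun n e he =>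
    hf0 _ (hmap n e (Metric.sphere_subset_closedBall he))
  have hkc : ∀ w ∈ Metric.ball (0 : ℂ) 1,
      ContinuousOn (fun e : ℂ => (e + w) / (e - w)) (Metric.sphere 0 1) := fun w hw =>
    ContinuousOn.div (by fun_prop) (by fun_prop) fun e he => sub_ne_zero_of_sphere_of_ball he hw
  let ν : ℕ → FiniteMeasure (Metric.sphere (0 : ℂ) 1) := fun n =>
    ⟨circleMeasure (u n), isFiniteMeasure_circleMeasure (huc n)⟩
  have hν : ∀ n, ∀ w ∈ Metric.ball (0 : ℂ) 1, g n w = Complex.I * (f 0).im +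
      ∫ e : Metric.sphere (0 : ℂ) 1, ((e : ℂ) + w) / (e - w) ∂(ν n : Measure _) := by
    intro n w hw
    rw [schwarz_integral_formula (hg n) hw, hg0]
    congr 1
    exact (integral_circleMeasure (huc n) (hu0 n) (hkc w hw)).symm
  -- At w = 0 the Herglotz kernel is identically 1, so every ν n has mass Re f(0). This keeps the
  -- sequence in a compact set of measures.
  have hmass : ∀ n, (ν n).mass ≤ (f 0).re.toNNReal := by
    intro n
    have h := hν n 0 (by simp)
    have h1 : ∫ e : Metric.sphere (0 : ℂ) 1, ((e : ℂ) + 0) / (e - 0) ∂(ν n : Measure _) =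
        ∫ e : Metric.sphere (0 : ℂ) 1, (1 : ℂ) ∂(ν n : Measure _) := by
      apply integral_congr_ae
      filter_upwards with e
      have : (e : ℂ) ≠ 0 := by
        have := sub_ne_zero_of_sphere_of_ball e.2 (w := 0) (by simp)
        simpa using this
      simp [this]
    rw [h1, hg0, integral_const] at h
    have h2 := congrArg Complex.re h
    simp at h2
    exact (Real.le_toNNReal_iff_coe_le (hf0 0 (by simp))).2 h2.ge
  have hcomp := isCompact_setOfPred_finiteMeasure_le_of_compactSpace (Metric.sphere (0 : ℂ) 1)
    (f 0).re.toNNReal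
  -- An ultrafilter finer than `atTop` takes the place of a convergent subsequence.
  let U : Ultrafilter ℕ := Ultrafilter.of atTop
  obtain ⟨μ, -, hμ⟩ := hcomp.ultrafilter_le_nhds (U.map ν) (by
    simp only [Ultrafilter.coe_map, le_principal_iff, mem_map]
    exact Filter.Eventually.of_forall hmass)
  have hμ' : Tendsto ν U (𝓝 μ) := hμ
  rw [FiniteMeasure.tendsto_iff_forall_integral_rclike_tendsto ℂ] at hμ'
  refine ⟨μ, inferInstance, fun w hw => ?_⟩
  have hw' : ContinuousAt f w :=
    (hf.differentiableAt (Metric.isOpen_ball.mem_nhds hw)).continuousAt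
  have hlim1 : Tendsto (fun n => g n w) U (𝓝 (f w)) := by
    have h1 : Tendsto (fun n => (r n : ℂ) * w) atTop (𝓝 w) := by
      have := ((Complex.continuous_ofReal.tendsto 1).comp hrt).mul_const w
      simpa using this
    exact (hw'.tendsto.comp h1).mono_left (Ultrafilter.of_le _)
  have hkc' : Continuous fun e : Metric.sphere (0 : ℂ) 1 => ((e : ℂ) + w) / (e - w) :=
    (hkc w hw).comp_continuous continuous_subtype_val fun e => e.2
  have hlim2 := (hμ' (BoundedContinuousFunction.mkOfCompact ⟨_, hkc'⟩)).const_add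
    (Complex.I * (f 0).im)
  refine tendsto_nhds_unique hlim1 (hlim2.congr fun n => ?_)
  exact (hν n w hw).symm

/-! ### Nevanlinna representation in the upper half-plane -/

/-- The kernel `1 / (t - z) - t / (1 + t ^ 2)` of the Nevanlinna representation. -/
def nevKernel (t : ℝ) (z : ℂ) : ℂ := 1 / ((t : ℂ) - z) - (t : ℂ) / (1 + (t : ℂ) ^ 2)

/-- The function `b z + a + ∫ (1 / (t - z) - t / (1 + t ^ 2)) dσ(t)`. -/
def nevFun (b a : ℝ) (σ : Measure ℝ) (z : ℂ) : ℂ :=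
  (b : ℂ) * z + (a : ℂ) + ∫ t : ℝ, nevKernel t z ∂σ

theorem ofReal_sub_ne_zero {z : ℂ} (hz : z.im ≠ 0) (t : ℝ) : (t : ℂ) - z ≠ 0 := by
  intro h
  have := congrArg Complex.im h
  simp at this
  exact hz this

theorem one_add_sq_ne_zero (t : ℝ) : 1 + (t : ℂ) ^ 2 ≠ 0 := by
  have : (1 + t ^ 2 : ℝ) ≠ 0 := by positivity
  exact_mod_cast this

theorem nevKernel_eq {z : ℂ} {t : ℝ} (h : (t : ℂ) - z ≠ 0) :
    nevKernel t z = (1 + t * z) / ((t - z) * (1 + (t : ℂ) ^ 2)) := by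
  have h2 := one_add_sq_ne_zero t
  rw [nevKernel]
  field_simp
  ring

/-- The inverse Cayley transform, from the unit circle without `1` to the real line. -/
def circleToReal (e : Metric.sphere (0 : ℂ) 1) : ℝ := -(e : ℂ).im / (1 - (e : ℂ).re)

theorem measurable_circleToReal : Measurable circleToReal := by
  have h : Measurable fun e : Metric.sphere (0 : ℂ) 1 => (e : ℂ) := measurable_subtype_coe
  exact (Complex.measurable_im.comp h).neg.div ((Complex.measurable_re.comp h).const_sub 1)

theorem mul_circleToReal_add_I {e : Metric.sphere (0 : ℂ) 1} (he : (e : ℂ) ≠ 1) :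
    (e : ℂ) * (circleToReal e + Complex.I) = circleToReal e - Complex.I := by
  have h1 : (e : ℂ).re ^ 2 + (e : ℂ).im ^ 2 = 1 := by
    have h : ‖(e : ℂ)‖ = 1 := by simp
    have := Complex.sq_norm (e : ℂ)
    rw [h, Complex.normSq_apply] at this
    linarith
  have h2 : 1 - (e : ℂ).re ≠ 0 := by
    intro h
    apply he
    have h3 : (e : ℂ).re = 1 := by linarith
    rw [h3] at h1
    have h4 : (e : ℂ).im = 0 := by nlinarith
    apply Complex.ext <;> simp [h3, h4]
  have ht : circleToReal e * (1 - (e : ℂ).re) = -(e : ℂ).im := div_mul_cancel₀ _ h2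
  apply Complex.ext
  · simp
    linarith
  · simp
    apply mul_left_cancel₀ h2
    linear_combination (e : ℂ).im * ht - h1

/-- **Nevanlinna representation**. -/
theorem IsNevanlinna.exists_nevFun {Φ : ℂ → ℂ} (hΦ : IsNevanlinna Φ) :
    ∃ (b a : ℝ) (σ : Measure ℝ), 0 ≤ b ∧ Integrable (fun t : ℝ => 1 / (1 + t ^ 2)) σ ∧
      Set.EqOn Φ (nevFun b a σ) upperHP := by
  -- The Cayley transform of the disc onto ℂ₊; the Herglotz representation is applied to -iΦ∘C,
  -- whose real part is Im Φ∘C.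
  let C : ℂ → ℂ := fun w => Complex.I * (1 + w) / (1 - w)
  have hsub : ∀ w ∈ Metric.ball (0 : ℂ) 1, 1 - w ≠ 0 := fun w hw =>
    sub_ne_zero_of_sphere_of_ball (by simp) hw
  have hCd : DifferentiableOn ℂ C (Metric.ball 0 1) := by
    intro w hw
    exact DifferentiableAt.differentiableWithinAt
      (DifferentiableAt.div (by fun_prop) (by fun_prop) (hsub w hw))
  have hCim : ∀ w ∈ Metric.ball (0 : ℂ) 1, C w ∈ upperHP := by
    intro w hw
    have h1 : ‖w‖ ^ 2 < 1 := by
      have : ‖w‖ < 1 := by simpa using hw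
      nlinarith [norm_nonneg w]
    have h2 : 0 < Complex.normSq (1 - w) := Complex.normSq_pos.2 (hsub w hw)
    have h3 : (C w).im = (1 - Complex.normSq w) / Complex.normSq (1 - w) := by
      simp only [C, Complex.div_im, Complex.normSq_apply]
      simp
      ring
    change 0 < (C w).im
    rw [h3]
    rw [Complex.sq_norm] at h1
    exact div_pos (by linarith) h2
  have hf : DifferentiableOn ℂ (fun w => -Complex.I * Φ (C w)) (Metric.ball 0 1) :=
    (hΦ.1.comp hCd hCim).const_mul _
  obtain ⟨μ, hμfin, hμ⟩ := herglotz_representation hf fun w hw => by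
    simp [hΦ.2 _ (hCim w hw)]
  -- The boundary point 1 corresponds to infinity. Its mass becomes the coefficient b; the rest of μ
  -- is moved to the line, and the density 1 + t² turns the Herglotz kernel, up to the factor i,
  -- into `nevKernel`.
  let one : Metric.sphere (0 : ℂ) 1 := ⟨1, by simp⟩
  let ν : Measure ℝ := (μ.restrict {one}ᶜ).map circleToReal
  have hνfin : IsFiniteMeasure ν := Measure.isFiniteMeasure_map _ _
  have hmeas : Measurable fun t : ℝ => (1 + t ^ 2).toNNReal := by fun_prop
  let σ : Measure ℝ := ν.withDensity fun t => ((1 + t ^ 2).toNNReal : ENNReal)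
  refine ⟨(μ {one}).toReal, (Φ Complex.I).re, σ, ENNReal.toReal_nonneg, ?_, ?_⟩
  · rw [integrable_withDensity_iff_integrable_smul hmeas]
    refine (integrable_const (1 : ℝ)).congr ?_
    filter_upwards with t
    have : (1 + t ^ 2 : ℝ) ≠ 0 := by positivity
    rw [NNReal.smul_def, Real.coe_toNNReal _ (by positivity)]
    simp [this]
  · intro z hz
    have hz0 : 0 < z.im := hz
    have hzI : z + Complex.I ≠ 0 := by
      intro h
      have := congrArg Complex.im h
      simp at this
      linarith
    let w := (z - Complex.I) / (z + Complex.I)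
    have hw : w ∈ Metric.ball (0 : ℂ) 1 := by
      rw [mem_ball_zero_iff, norm_div, div_lt_one (norm_pos_iff.2 hzI)]
      apply lt_of_pow_lt_pow_left₀ 2 (norm_nonneg _)
      rw [Complex.sq_norm, Complex.sq_norm, Complex.normSq_apply, Complex.normSq_apply]
      simp
      nlinarith
    have hCw : C w = z := by
      have := hsub w hw
      simp only [C, w] at this ⊢
      have h2 : (z + Complex.I) - (z - Complex.I) ≠ 0 := by
        intro h
        have : 2 * Complex.I = 0 := by linear_combination h
        simp at this
      field_simp
      ring
    have hC0 : C 0 = Complex.I := by simp [C]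
    have h1 := hμ w hw
    rw [hC0, hCw] at h1
    have h2 : Φ z = (Φ Complex.I).re +
        Complex.I * ∫ e : Metric.sphere (0 : ℂ) 1, ((e : ℂ) + w) / (e - w) ∂μ := by
      have h3 : Complex.I * (-Complex.I * Φ z) = Φ z := by
        rw [← mul_assoc]; simp
      rw [← h3, h1, mul_add, ← mul_assoc]
      simp
    have hkc : Continuous fun e : Metric.sphere (0 : ℂ) 1 => ((e : ℂ) + w) / (e - w) :=
      Continuous.div (by fun_prop) (by fun_prop)
        fun e => sub_ne_zero_of_sphere_of_ball e.2 hw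
    have hki : Integrable (fun e : Metric.sphere (0 : ℂ) 1 => ((e : ℂ) + w) / (e - w)) μ :=
      hkc.integrable_of_hasCompactSupport (HasCompactSupport.of_compactSpace _)
    have h4 : ∫ e : Metric.sphere (0 : ℂ) 1, ((e : ℂ) + w) / (e - w) ∂μ =
        (μ {one}).toReal * ((1 + w) / (1 - w)) +
        ∫ e in {one}ᶜ, ((e : ℂ) + w) / (e - w) ∂μ := by
      rw [← integral_add_compl (measurableSet_singleton one) hki]
      congr 1
      rw [integral_singleton]
      simp [one, Measure.real]
    have h5 : ∫ t, nevKernel t z ∂σ =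
        Complex.I * ∫ e in {one}ᶜ, ((e : ℂ) + w) / (e - w) ∂μ := by
      have hm : Measurable fun t : ℝ => nevKernel t z := by
        unfold nevKernel
        fun_prop
      rw [integral_withDensity_eq_integral_smul hmeas, integral_map
        measurable_circleToReal.aemeasurable, ← integral_const_mul]
      · apply setIntegral_congr_fun (measurableSet_singleton one).compl
        intro e he
        have he1 : (e : ℂ) ≠ 1 := fun h => he (Subtype.ext h)
        have h6 := mul_circleToReal_add_I he1
        simp only
        set t := circleToReal e
        have h7 := ofReal_sub_ne_zero hz0.ne' t
        have h8 := one_add_sq_ne_zero t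
        have h9 : (t : ℂ) + Complex.I ≠ 0 := by
          intro h
          have := congrArg Complex.im h
          simp at this
        have h10 : (e : ℂ) = (t - Complex.I) / (t + Complex.I) := by
          rw [eq_div_iff h9, h6]
        have h11 : (e : ℂ) - w ≠ 0 := sub_ne_zero_of_sphere_of_ball e.2 hw
        rw [nevKernel_eq h7, NNReal.smul_def, Complex.real_smul,
          Real.coe_toNNReal _ (by positivity)]
        push_cast
        have h12 : ((e : ℂ) + w) * ((t + Complex.I) * (z + Complex.I)) = 2 * (t * z + 1) := by
          rw [h10]; simp only [w]
          field_simp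
          ring_nf
          simp
          ring
        have h13 : ((e : ℂ) - w) * ((t + Complex.I) * (z + Complex.I)) =
            2 * Complex.I * (t - z) := by
          rw [h10]; simp only [w]
          field_simp
          ring
        have h14 : ((e : ℂ) + w) / (e - w) = (2 * (t * z + 1)) / (2 * Complex.I * (t - z)) := by
          rw [← h12, ← h13, mul_div_mul_right _ _ (mul_ne_zero h9 hzI)]
        rw [h14]
        have := Complex.I_ne_zero
        field_simp
        ring
      · exact (hmeas.smul hm).aestronglyMeasurable
    rw [h2, h4, nevFun, h5, mul_add]
    have h15 : Complex.I * ((1 + w) / (1 - w)) = z := by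
      rw [← mul_div_assoc]
      exact hCw
    linear_combination ((μ {one}).toReal : ℂ) * h15

/-! ### The kernel of `Φ(z) / z` -/

/-- |t - z| dominates both |Im z| and |t| - |z|. This is the source of the majorants C/(1 + t²) for
non-real z. -/
theorem one_add_abs_le {z : ℂ} (hz : z.im ≠ 0) (t : ℝ) :
    1 + |t| ≤ (1 + (1 + ‖z‖) / |z.im|) * ‖(t : ℂ) - z‖ := by
  have h1 : |z.im| ≤ ‖(t : ℂ) - z‖ := by
    simpa using Complex.abs_im_le_norm ((t : ℂ) - z)
  have h2 : |t| ≤ ‖(t : ℂ) - z‖ + ‖z‖ := by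
    simpa using norm_add_le ((t : ℂ) - z) z
  have h3 : 0 < |z.im| := abs_pos.2 hz
  have h4 : 1 + ‖z‖ ≤ (1 + ‖z‖) / |z.im| * ‖(t : ℂ) - z‖ := by
    rw [div_mul_eq_mul_div, le_div_iff₀ h3]
    gcongr
  linarith

theorem norm_nevKernel_le {z : ℂ} (hz : z.im ≠ 0) (t : ℝ) :
    ‖nevKernel t z‖ ≤ (1 + ‖z‖) * (1 + (1 + ‖z‖) / |z.im|) * (1 / (1 + t ^ 2)) := by
  have h1 := ofReal_sub_ne_zero hz t
  have h2 := one_add_abs_le hz t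
  have h3 : ‖(1 + (t : ℂ) ^ 2)‖ = 1 + t ^ 2 := by
    have : (1 + (t : ℂ) ^ 2) = ((1 + t ^ 2 : ℝ) : ℂ) := by push_cast; ring
    rw [this, Complex.norm_real, Real.norm_of_nonneg (by positivity)]
  have h4 : ‖1 + t * z‖ ≤ (1 + ‖z‖) * (1 + |t|) := by
    have := norm_add_le (1 : ℂ) (t * z)
    rw [norm_mul, Complex.norm_real, Real.norm_eq_abs, norm_one] at this
    nlinarith [norm_nonneg z, abs_nonneg t]
  have h5 : 0 < ‖(t : ℂ) - z‖ := norm_pos_iff.2 h1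
  rw [nevKernel_eq h1, norm_div, norm_mul, h3, ← div_div, mul_one_div]
  gcongr
  rw [div_le_iff₀ h5, mul_assoc]
  exact h4.trans (by gcongr)

theorem measurable_nevKernel (z : ℂ) : Measurable fun t : ℝ => nevKernel t z := by
  unfold nevKernel
  fun_prop

theorem integrable_nevKernel {σ : Measure ℝ} (hσ : Integrable (fun t : ℝ => 1 / (1 + t ^ 2)) σ)
    {z : ℂ} (hz : z.im ≠ 0) : Integrable (fun t => nevKernel t z) σ :=
  (hσ.const_mul _).mono' (measurable_nevKernel z).aestronglyMeasurable
    (Eventually.of_forall (norm_nevKernel_le hz))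

theorem nevKernel_conj (t : ℝ) (z : ℂ) : nevKernel t (conj z) = conj (nevKernel t z) := by
  simp [nevKernel]

theorem nevFun_conj (b a : ℝ) (σ : Measure ℝ) (z : ℂ) :
    nevFun b a σ (conj z) = conj (nevFun b a σ z) := by
  simp [nevFun, nevKernel_conj, integral_conj]

/-- The kernel of the Hermitian form generated by `nevKernel t z / z`, up to the factor
`1 / (z * conj w)`. -/
def polKernel (t : ℝ) (z w : ℂ) : ℂ :=
  t * ((t : ℂ) - z)⁻¹ * ((t : ℂ) - conj w)⁻¹ - ((t : ℂ) - z)⁻¹ - ((t : ℂ) - conj w)⁻¹ +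
    t / (1 + (t : ℂ) ^ 2)

theorem measurable_polKernel (z w : ℂ) : Measurable fun t : ℝ => polKernel t z w := by
  unfold polKernel
  fun_prop

/-- The terms of order 1/t cancel: over the common denominator the numerator is only linear in t.
The constant is continuous in z off the real axis, as dominated convergence will require. -/
theorem norm_polKernel_le {z w : ℂ} (hz : z.im ≠ 0) (hw : w.im ≠ 0) (t : ℝ) :
    ‖polKernel t z w‖ ≤ (1 + ‖z‖) * (1 + (1 + ‖z‖) / |z.im|) * ((1 + ‖w‖) / |w.im|) *
      (1 / (1 + t ^ 2)) := by
  have hw' : (conj w).im ≠ 0 := by simpa using hw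
  have h1 := ofReal_sub_ne_zero hz t
  have h1' := ofReal_sub_ne_zero hw' t
  have h2 := one_add_abs_le hz t
  have h0 := one_add_sq_ne_zero t
  have h3 : ‖(1 + (t : ℂ) ^ 2)‖ = 1 + t ^ 2 := by
    have : (1 + (t : ℂ) ^ 2) = ((1 + t ^ 2 : ℝ) : ℂ) := by push_cast; ring
    rw [this, Complex.norm_real, Real.norm_of_nonneg (by positivity)]
  have heq : polKernel t z w = ((z + conj w) + t * (z * conj w - 1)) /
      ((t - z) * (t - conj w) * (1 + (t : ℂ) ^ 2)) := by
    rw [polKernel]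
    field_simp
    ring
  have h4 : ‖(z + conj w) + t * (z * conj w - 1)‖ ≤ (1 + ‖z‖) * (1 + ‖w‖) * (1 + |t|) := by
    have e1 := norm_add_le (z + conj w) (t * (z * conj w - 1))
    have e2 := norm_add_le z (conj w)
    have e3 := norm_sub_le (z * conj w) 1
    rw [norm_mul, RCLike.norm_conj, norm_one] at e3
    rw [norm_mul, Complex.norm_real, Real.norm_eq_abs] at e1
    rw [RCLike.norm_conj] at e2
    have e4 := mul_le_mul_of_nonneg_left e3 (abs_nonneg t)
    nlinarith [norm_nonneg z, norm_nonneg w, abs_nonneg t,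
      mul_nonneg (norm_nonneg z) (norm_nonneg w),
      mul_nonneg (abs_nonneg t) (norm_nonneg z), mul_nonneg (abs_nonneg t) (norm_nonneg w)]
  have h5 : 0 < ‖(t : ℂ) - z‖ := norm_pos_iff.2 h1
  have h6 : |w.im| ≤ ‖(t : ℂ) - conj w‖ := by
    simpa using Complex.abs_im_le_norm ((t : ℂ) - conj w)
  have h7 : 0 < |w.im| := abs_pos.2 hw
  rw [heq, norm_div, norm_mul, norm_mul, h3]
  calc _ ≤ (1 + ‖z‖) * (1 + ‖w‖) * ((1 + (1 + ‖z‖) / |z.im|) * ‖(t : ℂ) - z‖) /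
        (‖(t : ℂ) - z‖ * |w.im| * (1 + t ^ 2)) := by
        gcongr
        exact h4.trans (by gcongr)
    _ = _ := by
        field_simp

theorem integrable_polKernel {σ : Measure ℝ} (hσ : Integrable (fun t : ℝ => 1 / (1 + t ^ 2)) σ)
    {z w : ℂ} (hz : z.im ≠ 0) (hw : w.im ≠ 0) : Integrable (fun t => polKernel t z w) σ :=
  (hσ.const_mul _).mono' (measurable_polKernel z w).aestronglyMeasurable
    (Eventually.of_forall (norm_polKernel_le hz hw))

/-- This identifies the diagonal value of the kernel, a derivative, with the limit of its
off-diagonal values. -/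
theorem continuousAt_integral_polKernel {σ : Measure ℝ}
    (hσ : Integrable (fun t : ℝ => 1 / (1 + t ^ 2)) σ) {z w : ℂ} (hz : z.im ≠ 0) (hw : w.im ≠ 0) :
    ContinuousAt (fun z => ∫ t, polKernel t z w ∂σ) z := by
  let C : ℂ → ℝ := fun z => (1 + ‖z‖) * (1 + (1 + ‖z‖) / |z.im|) * ((1 + ‖w‖) / |w.im|)
  have hC : ContinuousAt C z := by
    have h : ContinuousAt (fun z : ℂ => |z.im|) z := Complex.continuous_im.abs.continuousAt
    have h2 : ContinuousAt (fun z : ℂ => 1 + ‖z‖) z := by fun_prop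
    exact (h2.mul (continuousAt_const.add (h2.div h (abs_ne_zero.2 hz)))).mul continuousAt_const
  have hne : ∀ᶠ z' in 𝓝 z, z'.im ≠ 0 := Complex.continuous_im.continuousAt.eventually_ne hz
  apply continuousAt_of_dominated (bound := fun t => (C z + 1) * (1 / (1 + t ^ 2)))
  · filter_upwards with z'
    exact (measurable_polKernel z' w).aestronglyMeasurable
  · filter_upwards [hne, hC.eventually_lt continuousAt_const (lt_add_one (C z))] with z' h1 h2
    filter_upwards with t
    refine (norm_polKernel_le h1 hw t).trans ?_
    gcongr
  · exact hσ.const_mul _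
  · filter_upwards with t
    have h1 : ContinuousAt (fun z' : ℂ => ((t : ℂ) - z')⁻¹) z :=
      ContinuousAt.inv₀ (by fun_prop) (ofReal_sub_ne_zero hz t)
    unfold polKernel
    fun_prop

section PickKernel

variable {Φ : ℂ → ℂ} {b a : ℝ} {σ : Measure ℝ}

theorem symmExt_div_eq (hΦ : Set.EqOn Φ (nevFun b a σ) upperHP) {z : ℂ} (hz : z.im ≠ 0) :
    symmExt (fun z => Φ z / z) z = nevFun b a σ z / z := by
  rw [symmExt]
  split_ifs with h
  · rw [hΦ h]
  · have h2 : conj z ∈ upperHP := by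
      change 0 < (conj z).im
      rw [Complex.conj_im]
      rcases lt_or_gt_of_ne hz with h3 | h3
      · linarith
      · exact absurd h3 h
    rw [hΦ h2, nevFun_conj]
    simp

/-- The term bz/z is a real constant and cancels, while a/z - a/conj w contributes -a(z - conj w)/(z
conj w). The integral term is treated pointwise in t. -/
theorem pickQuotient_eq (hσ : Integrable (fun t : ℝ => 1 / (1 + t ^ 2)) σ)
    {z w : ℂ} (hz : z.im ≠ 0) (hw : w.im ≠ 0) (hzw : z ≠ conj w) :
    (nevFun b a σ z / z - conj (nevFun b a σ w / w)) / (z - conj w) =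
      (-a + ∫ t, polKernel t z w ∂σ) / (z * conj w) := by
  have hz0 : z ≠ 0 := by rintro rfl; simp at hz
  have hw0 : conj w ≠ 0 := by
    intro h
    have := congrArg Complex.im h
    simp at this
    exact hw this
  have hw' : (conj w).im ≠ 0 := by simpa using hw
  have hd : z - conj w ≠ 0 := sub_ne_zero.2 hzw
  have h1 : conj w * ∫ t, nevKernel t z ∂σ - z * ∫ t, nevKernel t (conj w) ∂σ =
      (z - conj w) * ∫ t, polKernel t z w ∂σ := by
    rw [← integral_const_mul, ← integral_const_mul, ← integral_const_mul, ← integral_sub]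
    · congr 1
      ext t
      have h1 := ofReal_sub_ne_zero hz t
      have h2 := ofReal_sub_ne_zero hw' t
      have h3 := one_add_sq_ne_zero t
      rw [polKernel, nevKernel, nevKernel]
      field_simp
      ring
    · exact (integrable_nevKernel hσ hz).const_mul _
    · exact (integrable_nevKernel hσ hw').const_mul _
  have h2 : conj w * nevFun b a σ z - z * nevFun b a σ (conj w) =
      (z - conj w) * (-a + ∫ t, polKernel t z w ∂σ) := by
    rw [nevFun, nevFun]
    linear_combination h1
  rw [map_div₀, ← nevFun_conj, div_sub_div _ _ hz0 hw0, div_div, div_eq_div_iff, mul_comm (nevFun b a σ z), h2]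
  · ring
  · exact mul_ne_zero (mul_ne_zero hz0 hw0) hd
  · exact mul_ne_zero hz0 hw0

theorem hasDerivAt_symmExt (hσ : Integrable (fun t : ℝ => 1 / (1 + t ^ 2)) σ)
    (hΦ : Set.EqOn Φ (nevFun b a σ) upperHP) {z : ℂ} (hz : z.im ≠ 0) :
    HasDerivAt (symmExt (fun z => Φ z / z))
      ((-a + ∫ t, polKernel t z (conj z) ∂σ) / (z * z)) z := by
  have hz' : (conj z).im ≠ 0 := by simpa using hz
  have hz0 : z ≠ 0 := by rintro rfl; simp at hz
  rw [hasDerivAt_iff_tendsto_slope]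
  have h1 : Tendsto (fun z' => (-a + ∫ t, polKernel t z' (conj z) ∂σ) / (z' * z)) (𝓝[≠] z)
      (𝓝 ((-a + ∫ t, polKernel t z (conj z) ∂σ) / (z * z))) := by
    have h : ContinuousAt (fun z' => (-a + ∫ t, polKernel t z' (conj z) ∂σ) / (z' * z)) z :=
      ContinuousAt.div (continuousAt_const.add (continuousAt_integral_polKernel hσ hz hz'))
        (by fun_prop) (mul_ne_zero hz0 hz0)
    exact h.tendsto.mono_left nhdsWithin_le_nhds
  refine h1.congr' ?_
  have hne : ∀ᶠ z' in 𝓝[≠] z, z'.im ≠ 0 :=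
    (Complex.continuous_im.continuousAt.eventually_ne hz).filter_mono nhdsWithin_le_nhds
  filter_upwards [hne, self_mem_nhdsWithin] with z' h2 h3
  -- With w = conj z the Pick quotient is exactly the slope of the extension between z and z'.
  have h4 := pickQuotient_eq (b := b) (a := a) hσ h2 hz' (by simpa using h3)
  rw [Complex.conj_conj, map_div₀, nevFun_conj, Complex.conj_conj, Complex.conj_conj] at h4
  rw [slope_def_field, symmExt_div_eq hΦ h2, symmExt_div_eq hΦ hz, h4]

theorem isAdmissible_of_nonreal (hσ : Integrable (fun t : ℝ => 1 / (1 + t ^ 2)) σ)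
    (hΦ : Set.EqOn Φ (nevFun b a σ) upperHP) {k : ℕ} {z : Fin k → ℂ} (hz : ∀ j, (z j).im ≠ 0) :
    IsAdmissible (fun z => Φ z / z) z := by
  intro j
  refine ⟨hz j, ?_⟩
  have hopen : IsOpen {z : ℂ | z.im ≠ 0} :=
    isOpen_ne.preimage Complex.continuous_im
  have hd : DifferentiableOn ℂ (symmExt (fun z => Φ z / z)) {z : ℂ | z.im ≠ 0} := fun z hz =>
    (hasDerivAt_symmExt hσ hΦ hz).differentiableAt.differentiableWithinAt
  exact hd.analyticAt (hopen.mem_nhds (hz j))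

theorem pickKernel_eq (hσ : Integrable (fun t : ℝ => 1 / (1 + t ^ 2)) σ)
    (hΦ : Set.EqOn Φ (nevFun b a σ) upperHP) {z w : ℂ} (hz : z.im ≠ 0) (hw : w.im ≠ 0) :
    pickKernel (fun z => Φ z / z) z w = (-a + ∫ t, polKernel t z w ∂σ) / (z * conj w) := by
  rw [pickKernel]
  split_ifs with h
  · rw [(hasDerivAt_symmExt hσ hΦ hz).deriv]
    subst h
    simp
  · rw [symmExt_div_eq hΦ hz, symmExt_div_eq hΦ hw]
    exact pickQuotient_eq hσ hz hw h

end PickKernel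

/-! ### The energy of a finite system of weighted points -/

/-- The sum `∑ η(z)` of the weights. -/
def totalWeight : (ℂ →₀ ℂ) →ₗ[ℂ] ℂ := Finsupp.linearCombination ℂ fun _ => (1 : ℂ)

/-- The sum `∑ η(z) / (t - z)`. -/
def cauchySum (t : ℝ) : (ℂ →₀ ℂ) →ₗ[ℂ] ℂ := Finsupp.linearCombination ℂ fun z => ((t : ℂ) - z)⁻¹

/-- The contribution of the point `t` to the energy of a system with total weight `S` and
Cauchy sum `F`. -/
def energyDensity (t : ℝ) (F S : ℂ) : ℝ :=
  t * ‖F‖ ^ 2 - 2 * (F * conj S).re + t / (1 + t ^ 2) * ‖S‖ ^ 2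

/-- The value of the Hermitian form of `Φ(z) / z` in terms of the representation of `Φ`. -/
def energy (a : ℝ) (σ : Measure ℝ) (η : ℂ →₀ ℂ) : ℝ :=
  -a * ‖totalWeight η‖ ^ 2 + ∫ t, energyDensity t (cauchySum t η) (totalWeight η) ∂σ

/-- The system of the points `z m` with the weights `c m`. -/
def pointSystem {k : ℕ} (z : Fin k → ℂ) (c : Fin k → ℂ) : ℂ →₀ ℂ :=
  ∑ m, Finsupp.single (z m) (c m)

theorem totalWeight_pointSystem {k : ℕ} (z c : Fin k → ℂ) :
    totalWeight (pointSystem z c) = ∑ m, c m := by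
  simp [totalWeight, pointSystem]

theorem cauchySum_pointSystem {k : ℕ} (z c : Fin k → ℂ) (t : ℝ) :
    cauchySum t (pointSystem z c) = ∑ m, c m * ((t : ℂ) - z m)⁻¹ := by
  simp [cauchySum, pointSystem]

/-- For fixed t the kernel is a Hermitian form in just two linear functionals of the weights, the
Cauchy sum and the total weight. -/
theorem sum_polKernel {k : ℕ} (z c : Fin k → ℂ) (t : ℝ) :
    ∑ n, ∑ m, polKernel t (z m) (z n) * (c m * conj (c n)) =
      (energyDensity t (cauchySum t (pointSystem z c)) (totalWeight (pointSystem z c)) : ℂ) := by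
  set F := cauchySum t (pointSystem z c) with hF
  set S := totalWeight (pointSystem z c) with hS
  rw [cauchySum_pointSystem] at hF
  rw [totalWeight_pointSystem] at hS
  have hFc : conj F = ∑ m, conj (c m) * ((t : ℂ) - conj (z m))⁻¹ := by simp [hF]
  have hSc : conj S = ∑ m, conj (c m) := by simp [hS]
  have h1 : ∑ n, ∑ m, polKernel t (z m) (z n) * (c m * conj (c n)) =
      t * (F * conj F) - F * conj S - S * conj F + t / (1 + (t : ℂ) ^ 2) * (S * conj S) := by
    rw [hFc, hSc, hF, hS]
    rw [Finset.sum_mul_sum, Finset.sum_mul_sum, Finset.sum_mul_sum, Finset.sum_mul_sum]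
    simp only [Finset.mul_sum, ← Finset.sum_sub_distrib, ← Finset.sum_add_distrib]
    rw [Finset.sum_comm]
    refine Finset.sum_congr rfl fun m _ => Finset.sum_congr rfl fun n _ => ?_
    rw [polKernel]
    ring
  have h2 : (2 * (F * conj S).re : ℂ) = F * conj S + S * conj F := by
    have := Complex.add_conj (F * conj S)
    rw [map_mul, Complex.conj_conj] at this
    push_cast at this
    linear_combination -this
  rw [h1, energyDensity, Complex.mul_conj', Complex.mul_conj']
  push_cast
  rw [h2]
  ring

theorem integrable_energyDensity {σ : Measure ℝ}
    (hσ : Integrable (fun t : ℝ => 1 / (1 + t ^ 2)) σ) {k : ℕ} {z : Fin k → ℂ}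
    (hz : ∀ j, (z j).im ≠ 0) (c : Fin k → ℂ) :
    Integrable (fun t => energyDensity t (cauchySum t (pointSystem z c))
      (totalWeight (pointSystem z c))) σ := by
  have h : Integrable (fun t => ∑ n, ∑ m, polKernel t (z m) (z n) * (c m * conj (c n))) σ :=
    integrable_finsetSum _ fun n _ => integrable_finsetSum _ fun m _ =>
      (integrable_polKernel hσ (hz m) (hz n)).mul_const _
  simp only [sum_polKernel] at h
  simpa using h.re

/-- The substitution ξ_m = z_m c_m absorbs the factor 1/(z conj w) of `pickKernel_eq`; what remains
is summed under the integral sign. -/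
theorem re_pickMatrix_form {Φ : ℂ → ℂ} {b a : ℝ} {σ : Measure ℝ}
    (hσ : Integrable (fun t : ℝ => 1 / (1 + t ^ 2)) σ)
    (hΦ : Set.EqOn Φ (nevFun b a σ) upperHP) {k : ℕ} {z : Fin k → ℂ} (hz : ∀ j, (z j).im ≠ 0)
    (c : Fin k → ℂ) :
    (star (fun m => z m * c m) ⬝ᵥ (pickMatrix (fun z => Φ z / z) z *ᵥ fun m => z m * c m)).re =
      energy a σ (pointSystem z c) := by
  have hz0 : ∀ j, z j ≠ 0 := fun j h => hz j (by simp [h])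
  have h1 : star (fun m => z m * c m) ⬝ᵥ (pickMatrix (fun z => Φ z / z) z *ᵥ fun m => z m * c m) =
      ∑ n, ∑ m, (-a + ∫ t, polKernel t (z m) (z n) ∂σ) * (c m * conj (c n)) := by
    simp only [dotProduct, Matrix.mulVec, Finset.mul_sum]
    refine Finset.sum_congr rfl fun n _ => Finset.sum_congr rfl fun m _ => ?_
    simp only [pickMatrix, Matrix.of_apply, pickKernel_eq hσ hΦ (hz m) (hz n), Pi.star_apply,
      star_mul', Complex.star_def]
    have h2 := hz0 m
    have h3 : conj (z n) ≠ 0 := by simpa using hz0 n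
    field_simp
  have h2 : ∑ n, ∑ m, (-a + ∫ t, polKernel t (z m) (z n) ∂σ) * (c m * conj (c n)) =
      (energy a σ (pointSystem z c) : ℂ) := by
    have h3 : ∑ n, ∑ m, (-a : ℂ) * (c m * conj (c n)) =
        -a * ((‖totalWeight (pointSystem z c)‖ ^ 2 : ℝ) : ℂ) := by
      push_cast
      rw [← Complex.mul_conj', totalWeight_pointSystem, map_sum, Finset.sum_mul_sum,
        Finset.mul_sum, Finset.sum_comm]
      simp only [Finset.mul_sum]
    have h4 : ∑ n, ∑ m, (∫ t, polKernel t (z m) (z n) ∂σ) * (c m * conj (c n)) =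
        ((∫ t, energyDensity t (cauchySum t (pointSystem z c))
          (totalWeight (pointSystem z c)) ∂σ : ℝ) : ℂ) := by
      rw [← integral_complex_ofReal]
      simp only [← sum_polKernel]
      rw [integral_finsetSum]
      · refine Finset.sum_congr rfl fun n _ => ?_
        rw [integral_finsetSum]
        · simp only [integral_mul_const]
        · exact fun m _ => (integrable_polKernel hσ (hz m) (hz n)).mul_const _
      · exact fun n _ => integrable_finsetSum _ fun m _ =>
          (integrable_polKernel hσ (hz m) (hz n)).mul_const _
    rw [energy]
    push_cast at h3 h4 ⊢
    rw [← h3, ← h4]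
    simp only [add_mul, Finset.sum_add_distrib]
  rw [h1, h2, Complex.ofReal_re]

/-! ### Bounds for the number of negative squares in terms of the energy -/

section Bounds

variable {Φ : ℂ → ℂ} {b a : ℝ} {σ : Measure ℝ}

theorem pointSystem_add {k : ℕ} (z c d : Fin k → ℂ) :
    pointSystem z (c + d) = pointSystem z c + pointSystem z d := by
  simp [pointSystem, Finset.sum_add_distrib]

theorem pointSystem_smul {k : ℕ} (z : Fin k → ℂ) (r : ℂ) (c : Fin k → ℂ) :
    pointSystem z (r • c) = r • pointSystem z c := by
  simp [pointSystem, Finset.smul_sum]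

/-- `pointSystem` with fixed points, as a linear map in the vector of the Hermitian form. -/
def pointSystemLinear {k : ℕ} (z : Fin k → ℂ) : (Fin k → ℂ) →ₗ[ℂ] (ℂ →₀ ℂ) where
  toFun ξ := pointSystem z fun m => (z m)⁻¹ * ξ m
  map_add' ξ ζ := by
    rw [← pointSystem_add]
    congr 1
    ext m
    simp [mul_add]
  map_smul' r ξ := by
    rw [RingHom.id_apply, ← pointSystem_smul]
    congr 1
    ext m
    simp
    ring

theorem re_pickMatrix_form' (hσ : Integrable (fun t : ℝ => 1 / (1 + t ^ 2)) σ)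
    (hΦ : Set.EqOn Φ (nevFun b a σ) upperHP) {k : ℕ} {z : Fin k → ℂ} (hz : ∀ j, (z j).im ≠ 0)
    (ξ : Fin k → ℂ) :
    (star ξ ⬝ᵥ (pickMatrix (fun z => Φ z / z) z *ᵥ ξ)).re =
      energy a σ (pointSystemLinear z ξ) := by
  have hz0 : ∀ j, z j ≠ 0 := fun j h => hz j (by simp [h])
  have h := re_pickMatrix_form hσ hΦ hz fun m => (z m)⁻¹ * ξ m
  have h2 : (fun m => z m * ((z m)⁻¹ * ξ m)) = ξ := by
    ext m
    rw [mul_inv_cancel_left₀ (hz0 m)]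
  rw [h2] at h
  exact h

/-- A subspace on which the form is negative definite meets the kernel of l only in 0, so it embeds
into W. -/
theorem negSquares_le_of_energy_nonneg (hσ : Integrable (fun t : ℝ => 1 / (1 + t ^ 2)) σ)
    (hΦ : Set.EqOn Φ (nevFun b a σ) upperHP) {W : Type*} [AddCommGroup W] [Module ℂ W]
    [FiniteDimensional ℂ W] (l : (ℂ →₀ ℂ) →ₗ[ℂ] W) {k : ℕ} {z : Fin k → ℂ}
    (hz : ∀ j, (z j).im ≠ 0)
    (h : ∀ c, l (pointSystem z c) = 0 → 0 ≤ energy a σ (pointSystem z c)) :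
    negSquares (pickMatrix (fun z => Φ z / z) z) ≤ Module.finrank ℂ W := by
  obtain ⟨V, hV, hneg⟩ := (negSquares_isGreatest (pickMatrix (fun z => Φ z / z) z)).1
  rw [← hV]
  apply LinearMap.finrank_le_finrank_of_injective (f := (l ∘ₗ pointSystemLinear z) ∘ₗ V.subtype)
  rw [← LinearMap.ker_eq_bot, LinearMap.ker_eq_bot']
  intro ξ hξ
  by_contra hne
  have h1 := hneg ξ ξ.2 (by simpa using hne)
  rw [re_pickMatrix_form' hσ hΦ hz] at h1
  exact absurd h1 (not_lt.2 (h _ hξ))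

/-- The enumeration of a finite set of points. -/
def enumPoints (s : Finset ℂ) (j : Fin s.card) : ℂ := s.equivFin.symm j

theorem enumPoints_mem (s : Finset ℂ) (j : Fin s.card) : enumPoints s j ∈ s :=
  (s.equivFin.symm j).2

theorem pointSystem_enumPoints {s : Finset ℂ} {η : ℂ →₀ ℂ} (h : η.support ⊆ s) :
    pointSystem (enumPoints s) (fun m => η (enumPoints s m)) = η := by
  rw [pointSystem]
  conv_rhs => rw [← Finsupp.sum_single η]
  rw [Finsupp.sum_of_support_subset _ h _ (by simp), ← Finset.sum_coe_sort s]
  exact Fintype.sum_equiv s.equivFin.symm _ _ fun m => rfl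

theorem integrable_energyDensity' (hσ : Integrable (fun t : ℝ => 1 / (1 + t ^ 2)) σ)
    {η : ℂ →₀ ℂ} {s : Finset ℂ} (hs : ∀ z ∈ s, z.im ≠ 0) (h : η.support ⊆ s) :
    Integrable (fun t => energyDensity t (cauchySum t η) (totalWeight η)) σ := by
  have := integrable_energyDensity hσ (fun j => hs _ (enumPoints_mem s j))
    fun m => η (enumPoints s m)
  rwa [pointSystem_enumPoints h] at this

/-- The common finite support s places the whole family of systems inside one Pick matrix.
Negativity of the energy also makes the map from W to the vectors of the form injective. -/
theorem exists_le_negSquares (hσ : Integrable (fun t : ℝ => 1 / (1 + t ^ 2)) σ)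
    (hΦ : Set.EqOn Φ (nevFun b a σ) upperHP) {W : Type*} [AddCommGroup W] [Module ℂ W]
    [FiniteDimensional ℂ W] (u : W →ₗ[ℂ] (ℂ →₀ ℂ)) {s : Finset ℂ} (hs : ∀ z ∈ s, z.im ≠ 0)
    (hus : ∀ c, (u c).support ⊆ s) (hneg : ∀ c, c ≠ 0 → energy a σ (u c) < 0) :
    ∃ (k : ℕ) (z : Fin k → ℂ), Function.Injective z ∧ (∀ j, (z j).im ≠ 0) ∧
      Module.finrank ℂ W ≤ negSquares (pickMatrix (fun z => Φ z / z) z) := by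
  let z : Fin s.card → ℂ := enumPoints s
  have hz : ∀ j, (z j).im ≠ 0 := fun j => hs _ (enumPoints_mem s j)
  have hz0 : ∀ j, z j ≠ 0 := fun j h => hz j (by simp [h])
  refine ⟨s.card, z, Subtype.val_injective.comp s.equivFin.symm.injective, hz, ?_⟩
  let T : W →ₗ[ℂ] (Fin s.card → ℂ) :=
    { toFun := fun c m => z m * u c (z m)
      map_add' := fun c d => by
        ext m
        simp [mul_add]
      map_smul' := fun r c => by
        ext m
        simp
        ring }
  have hT : ∀ c, pointSystemLinear z (T c) = u c := by
    intro c
    change pointSystem z (fun m => (z m)⁻¹ * (z m * u c (z m))) = u c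
    have h1 : (fun m => (z m)⁻¹ * (z m * u c (z m))) = fun m => u c (z m) := by
      ext m
      rw [inv_mul_cancel_left₀ (hz0 m)]
    rw [h1]
    exact pointSystem_enumPoints (hus c)
  have hform : ∀ c, (star (T c) ⬝ᵥ (pickMatrix (fun z => Φ z / z) z *ᵥ (T c))).re =
      energy a σ (u c) := fun c => by
    rw [re_pickMatrix_form' hσ hΦ hz, hT]
  have hinj : Function.Injective T := by
    rw [← LinearMap.ker_eq_bot, LinearMap.ker_eq_bot']
    intro c hc
    by_contra hne
    have h1 := hneg c hne
    rw [← hform, hc] at h1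
    simp at h1
  apply (negSquares_isGreatest (pickMatrix (fun z => Φ z / z) z)).2
  refine ⟨LinearMap.range T, LinearMap.finrank_range_of_inj hinj, ?_⟩
  rintro ξ ⟨c, rfl⟩ hξ
  rw [hform]
  exact hneg c fun h => hξ (by simp [h])

/-- When S = 0 and F vanishes at every p j, the energy is ∫ t|F|² dσ and only t ≥ 0 contributes.
These are n + 1 linear conditions. -/
theorem negSquares_le_add_one (hσ : Integrable (fun t : ℝ => 1 / (1 + t ^ 2)) σ)
    (hΦ : Set.EqOn Φ (nevFun b a σ) upperHP) {n : ℕ} {p : Fin n → ℝ}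
    (hp : ∀ᵐ t ∂σ, 0 ≤ t ∨ ∃ j, t = p j) {k : ℕ} {z : Fin k → ℂ} (hz : ∀ j, (z j).im ≠ 0) :
    negSquares (pickMatrix (fun z => Φ z / z) z) ≤ n + 1 := by
  have h := negSquares_le_of_energy_nonneg hσ hΦ
    ((LinearMap.pi fun j => cauchySum (p j)).prod totalWeight) hz (fun c hc => ?_)
  · simpa using h
  · replace hc := Prod.mk_eq_zero.1 hc
    rw [energy, hc.2]
    simp only [norm_zero]
    have h1 : 0 ≤ ∫ t, energyDensity t (cauchySum t (pointSystem z c)) 0 ∂σ := by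
      apply integral_nonneg_of_ae
      filter_upwards [hp] with t ht
      simp only [Pi.zero_apply, energyDensity]
      rcases ht with ht | ⟨j, rfl⟩
      · simp
        positivity
      · have := congrFun hc.1 j
        simp only [LinearMap.pi_apply, Pi.zero_apply] at this
        simp [this]
    simpa using h1

/-- Completing the square in F. The last term, once integrated, combines with -a‖S‖² to give
-Φ(0-)‖S‖² when the integral converges. -/
theorem energyDensity_eq {t : ℝ} (ht : t ≠ 0) (F S : ℂ) :
    energyDensity t F S = t⁻¹ * ‖t * F - S‖ ^ 2 - 1 / (t + t ^ 3) * ‖S‖ ^ 2 := by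
  have h1 : ‖t * F - S‖ ^ 2 = t ^ 2 * ‖F‖ ^ 2 - 2 * t * (F * conj S).re + ‖S‖ ^ 2 := by
    rw [Complex.sq_norm, Complex.sq_norm, Complex.sq_norm]
    simp [Complex.normSq_apply]
    ring
  have h2 : t + t ^ 3 = t * (1 + t ^ 2) := by ring
  have h3 : (1 + t ^ 2) ≠ 0 := by positivity
  rw [h1, energyDensity, h2]
  field_simp
  ring

/-- The n conditions p_j F(p_j) = S remove the squares at the p_j. The squares over t > 0 are
nonnegative, and what is left is a nonpositive constant times -‖S‖². -/
theorem negSquares_le_of_value_nonpos (hσ : Integrable (fun t : ℝ => 1 / (1 + t ^ 2)) σ)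
    (hΦ : Set.EqOn Φ (nevFun b a σ) upperHP) {n : ℕ} {p : Fin n → ℝ} (hp0 : ∀ j, p j ≠ 0)
    (hp : ∀ᵐ t ∂σ, 0 < t ∨ ∃ j, t = p j)
    (hint : Integrable (fun t : ℝ => 1 / (t + t ^ 3)) σ)
    (hval : a + ∫ t, 1 / (t + t ^ 3) ∂σ ≤ 0) {k : ℕ} {z : Fin k → ℂ} (hz : ∀ j, (z j).im ≠ 0) :
    negSquares (pickMatrix (fun z => Φ z / z) z) ≤ n := by
  have h := negSquares_le_of_energy_nonneg hσ hΦ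
    (LinearMap.pi fun j => (p j : ℂ) • cauchySum (p j) - totalWeight) hz (fun c hc => ?_)
  · simpa using h
  · have h1 : ∫ t, -(1 / (t + t ^ 3) * ‖totalWeight (pointSystem z c)‖ ^ 2) ∂σ ≤
        ∫ t, energyDensity t (cauchySum t (pointSystem z c))
          (totalWeight (pointSystem z c)) ∂σ := by
      apply integral_mono_ae (hint.mul_const _).neg (integrable_energyDensity hσ hz c)
      filter_upwards [hp] with t ht
      simp only [Pi.neg_apply]
      rcases ht with ht | ⟨j, rfl⟩
      · rw [energyDensity_eq ht.ne', neg_le_sub_iff_le_add]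
        exact le_add_of_nonneg_left (by positivity)
      · have := congrFun hc j
        simp only [LinearMap.pi_apply, Pi.zero_apply, LinearMap.sub_apply, LinearMap.smul_apply,
          smul_eq_mul] at this
        rw [energyDensity_eq (hp0 j), this]
        simp
    rw [integral_neg, integral_mul_const] at h1
    rw [energy]
    nlinarith [sq_nonneg ‖totalWeight (pointSystem z c)‖]

end Bounds

/-! ### Negative directions concentrated near points of the negative half-line -/

/-- The system of the points `x ± i ε` whose Cauchy sum is `ε² / ((t - x)² + ε²)`. -/
def poissonPair (x ε : ℝ) : ℂ →₀ ℂ :=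
  Finsupp.single ((x : ℂ) + ε * Complex.I) ((ε : ℂ) / (2 * Complex.I)) -
    Finsupp.single ((x : ℂ) - ε * Complex.I) ((ε : ℂ) / (2 * Complex.I))

/-- The function `ε² / ((t - x)² + ε²)`. -/
def bump (x ε t : ℝ) : ℝ := ε ^ 2 / ((t - x) ^ 2 + ε ^ 2)

theorem totalWeight_poissonPair (x ε : ℝ) : totalWeight (poissonPair x ε) = 0 := by
  simp [totalWeight, poissonPair]

theorem cauchySum_poissonPair (x : ℝ) {ε : ℝ} (hε : ε ≠ 0) (t : ℝ) :
    cauchySum t (poissonPair x ε) = (bump x ε t : ℂ) := by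
  have h1 := ofReal_sub_ne_zero (z := (x : ℂ) + ε * Complex.I) (by simpa using hε) t
  have h2 := ofReal_sub_ne_zero (z := (x : ℂ) - ε * Complex.I) (by simpa using hε) t
  have h3 : ((t : ℂ) - x) ^ 2 + ε ^ 2 =
      ((t : ℂ) - (x + ε * Complex.I)) * (t - (x - ε * Complex.I)) := by
    linear_combination (ε : ℂ) ^ 2 * Complex.I_sq
  simp only [cauchySum, poissonPair, map_sub, Finsupp.linearCombination_single, smul_eq_mul, bump]
  push_cast
  rw [h3]
  have := Complex.I_ne_zero
  field_simp
  ring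

theorem poissonPair_support (x ε : ℝ) :
    (poissonPair x ε).support ⊆ {(x : ℂ) + ε * Complex.I, (x : ℂ) - ε * Complex.I} := by
  refine Finsupp.support_sub.trans (Finset.union_subset ?_ ?_)
  · exact Finsupp.support_single_subset.trans (by simp)
  · exact Finsupp.support_single_subset.trans (by simp)

theorem bump_nonneg (x ε t : ℝ) : 0 ≤ bump x ε t := by
  unfold bump
  positivity

theorem norm_sum_bump_sq_le {N : ℕ} (x : Fin N → ℝ) (c : Fin N → ℂ) {ε t B : ℝ}
    (s : Finset (Fin N)) (hB : ∀ j ∈ s, bump (x j) ε t ≤ B) :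
    ‖∑ j ∈ s, c j * (bump (x j) ε t : ℂ)‖ ^ 2 ≤ N * (∑ j, ‖c j‖ ^ 2) * B ^ 2 := by
  have h1 : ‖∑ j ∈ s, c j * (bump (x j) ε t : ℂ)‖ ≤ ∑ j ∈ s, ‖c j * (bump (x j) ε t : ℂ)‖ :=
    norm_sum_le _ _
  have h2 : (∑ j ∈ s, ‖c j * (bump (x j) ε t : ℂ)‖) ^ 2 ≤
      s.card * ∑ j ∈ s, ‖c j * (bump (x j) ε t : ℂ)‖ ^ 2 := sq_sum_le_card_mul_sum_sq
  have h3 : ∑ j ∈ s, ‖c j * (bump (x j) ε t : ℂ)‖ ^ 2 ≤ ∑ j ∈ s, ‖c j‖ ^ 2 * B ^ 2 := by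
    apply Finset.sum_le_sum
    intro j hj
    rw [norm_mul, mul_pow, Complex.norm_real, Real.norm_of_nonneg (bump_nonneg _ _ _)]
    have := hB j hj
    have := bump_nonneg (x j) ε t
    gcongr
  have h4 : ∑ j ∈ s, ‖c j‖ ^ 2 * B ^ 2 ≤ ∑ j, ‖c j‖ ^ 2 * B ^ 2 :=
    Finset.sum_le_sum_of_subset_of_nonneg (Finset.subset_univ s) fun j _ _ => by positivity
  have h5 : (s.card : ℝ) ≤ N := by
    have := s.card_le_univ
    rw [Fintype.card_fin] at this
    exact_mod_cast this
  calc _ ≤ (∑ j ∈ s, ‖c j * (bump (x j) ε t : ℂ)‖) ^ 2 := by gcongr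
    _ ≤ _ := h2
    _ ≤ N * ∑ j, ‖c j‖ ^ 2 * B ^ 2 := by
        gcongr
        exact h3.trans h4
    _ = _ := by
        rw [← Finset.sum_mul]
        ring

/-- For systems of zero total weight, the left side is the energy density. Near x i one bump
dominates and t ≤ -δ gives a definite negative amount; all other bumps are O(ε²/(1 + t²)), and in
their squared sum one factor 1 + t² absorbs |t|. -/
theorem mul_norm_sum_bump_sq_le {N : ℕ} {x : Fin N → ℝ} {δ A ε : ℝ} (hδ : 0 < δ)
    (hsep : ∀ i j, i ≠ j → 2 * δ < |x i - x j|) (hneg : ∀ i, x i ≤ -(2 * δ)) (hε : 0 < ε)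
    (hεδ : ε ≤ δ) (hA : ∀ i t, δ ≤ |t - x i| → 1 + t ^ 2 ≤ A * (t - x i) ^ 2) (c : Fin N → ℂ)
    (t : ℝ) :
    t * ‖∑ i, c i * (bump (x i) ε t : ℂ)‖ ^ 2 ≤
      -(δ / 8 * ∑ i, ‖c i‖ ^ 2 * (Metric.closedBall (x i) ε).indicator 1 t) +
        N * (∑ i, ‖c i‖ ^ 2) * A ^ 2 * ε ^ 4 * (1 / (1 + t ^ 2)) := by
  set K := ∑ i, ‖c i‖ ^ 2 with hK
  have hK0 : 0 ≤ K := Finset.sum_nonneg fun _ _ => by positivity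
  have ht2 : (0 : ℝ) < 1 + t ^ 2 := by positivity
  have hfar : ∀ i, δ ≤ |t - x i| → bump (x i) ε t ≤ A * ε ^ 2 / (1 + t ^ 2) := by
    intro i hi
    have h1 := hA i t hi
    have h2 : 0 < (t - x i) ^ 2 := by
      rw [← sq_abs]
      have : 0 < |t - x i| := hδ.trans_le hi
      positivity
    rw [bump, div_le_div_iff₀ (by positivity) ht2]
    have h3 : 0 < A := by
      by_contra h
      nlinarith
    nlinarith [sq_nonneg ε, mul_le_mul_of_nonneg_left h1 (sq_nonneg ε), mul_pos h3 (pow_pos hε 4)]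
  have hrem : ∀ s : Finset (Fin N), (∀ j ∈ s, δ ≤ |t - x j|) →
      |t| * ‖∑ j ∈ s, c j * (bump (x j) ε t : ℂ)‖ ^ 2 ≤
        N * K * A ^ 2 * ε ^ 4 * (1 / (1 + t ^ 2)) := by
    intro s hs
    have h1 := norm_sum_bump_sq_le x c s fun j hj => hfar j (hs j hj)
    have h2 : |t| ≤ 1 + t ^ 2 := by
      rw [← sq_abs]
      nlinarith [abs_nonneg t, sq_nonneg (|t| - 1)]
    calc _ ≤ (1 + t ^ 2) * (N * K * (A * ε ^ 2 / (1 + t ^ 2)) ^ 2) := by gcongr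
      _ = _ := by
        field_simp
  -- The points are more than 2δ apart, so t is within δ of at most one of them.
  by_cases h : ∃ i, |t - x i| ≤ δ
  · obtain ⟨i, hi⟩ := h
    have hother : ∀ j, j ≠ i → δ < |t - x j| := by
      intro j hj
      have h1 := hsep j i hj
      have h2 : |x j - x i| ≤ |t - x j| + |t - x i| := by
        have := abs_sub_le (x j) t (x i)
        rwa [abs_sub_comm (x j) t] at this
      linarith
    have htδ : t ≤ -δ := by
      have := (abs_le.1 hi).2
      linarith [hneg i]
    have h1 : ∑ j, ‖c j‖ ^ 2 * (Metric.closedBall (x j) ε).indicator 1 t =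
        ‖c i‖ ^ 2 * (Metric.closedBall (x i) ε).indicator 1 t := by
      apply Finset.sum_eq_single
      · intro j _ hj
        rw [Set.indicator_of_notMem, mul_zero]
        rw [Metric.mem_closedBall, Real.dist_eq]
        linarith [hother j hj]
      · simp
    have h2 := hrem (Finset.univ.erase i) fun j hj => (hother j (Finset.ne_of_mem_erase hj)).le
    rw [h1, ← Finset.add_sum_erase _ _ (Finset.mem_univ i)]
    set R := ∑ j ∈ Finset.univ.erase i, c j * (bump (x j) ε t : ℂ)
    -- Separating the far bumps R costs a factor 2, and the bump is at least 1/2 on the ball, hence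
    -- its square at least 1/4; together they give the 1/8.
    have h3 : ‖c i * (bump (x i) ε t : ℂ)‖ ^ 2 ≤
        2 * ‖c i * (bump (x i) ε t : ℂ) + R‖ ^ 2 + 2 * ‖R‖ ^ 2 := by
      have h4 := norm_sub_le (c i * (bump (x i) ε t : ℂ) + R) R
      rw [add_sub_cancel_right] at h4
      have h5 := pow_le_pow_left₀ (norm_nonneg _) h4 2
      nlinarith [sq_nonneg (‖c i * (bump (x i) ε t : ℂ) + R‖ - ‖R‖)]
    have h4 : 1 / 4 * (Metric.closedBall (x i) ε).indicator 1 t ≤ bump (x i) ε t ^ 2 := by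
      by_cases hb : t ∈ Metric.closedBall (x i) ε
      · rw [Set.indicator_of_mem hb]
        rw [Metric.mem_closedBall, Real.dist_eq] at hb
        have h5 : (t - x i) ^ 2 ≤ ε ^ 2 := by
          rw [← sq_abs]
          gcongr
        have h6 : 1 / 2 ≤ bump (x i) ε t := by
          rw [bump, div_le_div_iff₀ (by norm_num) (by positivity)]
          linarith
        simp only [Pi.one_apply]
        nlinarith
      · rw [Set.indicator_of_notMem hb, mul_zero]
        positivity
    rw [norm_mul, mul_pow, Complex.norm_real, Real.norm_of_nonneg (bump_nonneg _ _ _)] at h3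
    have h5 := mul_le_mul_of_nonneg_left h4 (sq_nonneg ‖c i‖)
    rw [abs_of_neg (by linarith : t < 0)] at h2
    have h6 := h5.trans h3
    set X := ‖c i * (bump (x i) ε t : ℂ) + R‖ ^ 2
    set I := ‖c i‖ ^ 2 * (Metric.closedBall (x i) ε).indicator 1 t with hI
    have hI0 : 0 ≤ I := by
      have : (0 : ℝ) ≤ (Metric.closedBall (x i) ε).indicator 1 t :=
        Set.indicator_nonneg (fun _ _ => by simp) t
      positivity
    have h7 : 1 / 4 * I ≤ 2 * X + 2 * ‖R‖ ^ 2 := by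
      rw [hI]; linarith
    nlinarith [mul_le_mul_of_nonneg_left h7 (by linarith : 0 ≤ -t),
      mul_nonneg hI0 (by linarith : 0 ≤ -t - δ)]
  · push Not at h
    have h1 : ∑ j, ‖c j‖ ^ 2 * (Metric.closedBall (x j) ε).indicator 1 t = 0 := by
      apply Finset.sum_eq_zero
      intro j _
      rw [Set.indicator_of_notMem, mul_zero]
      rw [Metric.mem_closedBall, Real.dist_eq]
      linarith [h j]
    rw [h1, mul_zero, neg_zero, zero_add]
    refine le_trans ?_ (hrem Finset.univ fun j _ => (h j).le)
    gcongr
    exact le_abs_self t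

/-- The linear family of systems generated by `poissonPair (x i) ε`. -/
def poissonSystem {N : ℕ} (x : Fin N → ℝ) (ε : ℝ) : (Fin N → ℂ) →ₗ[ℂ] (ℂ →₀ ℂ) :=
  Fintype.linearCombination ℂ fun i => poissonPair (x i) ε

theorem totalWeight_poissonSystem {N : ℕ} (x : Fin N → ℝ) (ε : ℝ) (c : Fin N → ℂ) :
    totalWeight (poissonSystem x ε c) = 0 := by
  simp [poissonSystem, Fintype.linearCombination_apply, totalWeight_poissonPair]

theorem cauchySum_poissonSystem {N : ℕ} (x : Fin N → ℝ) {ε : ℝ} (hε : ε ≠ 0) (c : Fin N → ℂ)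
    (t : ℝ) : cauchySum t (poissonSystem x ε c) = ∑ i, c i * (bump (x i) ε t : ℂ) := by
  simp [poissonSystem, Fintype.linearCombination_apply, cauchySum_poissonPair _ hε]

/-- The points of `poissonSystem x ε`. -/
def poissonPoints {N : ℕ} (x : Fin N → ℝ) (ε : ℝ) : Finset ℂ :=
  Finset.univ.biUnion fun i => {(x i : ℂ) + ε * Complex.I, (x i : ℂ) - ε * Complex.I}

theorem poissonSystem_support {N : ℕ} (x : Fin N → ℝ) (ε : ℝ) (c : Fin N → ℂ) :
    (poissonSystem x ε c).support ⊆ poissonPoints x ε := by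
  rw [poissonSystem, Fintype.linearCombination_apply]
  refine Finsupp.support_finsetSum.trans ?_
  apply Finset.biUnion_mono
  intro i _
  exact Finsupp.support_smul.trans (poissonPair_support (x i) ε)

theorem im_ne_zero_of_mem_poissonPoints {N : ℕ} {x : Fin N → ℝ} {ε : ℝ} (hε : ε ≠ 0) {z : ℂ}
    (hz : z ∈ poissonPoints x ε) : z.im ≠ 0 := by
  simp only [poissonPoints, Finset.mem_biUnion, Finset.mem_univ, true_and, Finset.mem_insert,
    Finset.mem_singleton] at hz
  obtain ⟨i, rfl | rfl⟩ := hz <;> simpa using hε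

/-- The measure of small intervals around `x` is at least proportional to their length. -/
def HasPositiveLowerDensity (σ : Measure ℝ) (x : ℝ) : Prop :=
  ∃ m : ℝ, 0 < m ∧ ∀ᶠ r in 𝓝[>] (0 : ℝ), ENNReal.ofReal (m * r) ≤ σ (Metric.closedBall x r)

theorem measure_closedBall_lt_top {σ : Measure ℝ}
    (hσ : Integrable (fun t : ℝ => 1 / (1 + t ^ 2)) σ) (x r : ℝ) :
    σ (Metric.closedBall x r) < ⊤ := by
  have h := hσ.measure_norm_ge_lt_top (ε := 1 / (1 + (|x| + r) ^ 2)) (by positivity)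
  refine (measure_mono fun t ht => ?_).trans_lt h
  rw [Metric.mem_closedBall, Real.dist_eq] at ht
  rw [Set.mem_ofPred_eq, Real.norm_of_nonneg (by positivity)]
  have h1 : |t| ≤ |x| + r := by
    have := abs_add_le (t - x) x
    rw [sub_add_cancel] at this
    linarith
  have h2 : t ^ 2 ≤ (|x| + r) ^ 2 := by
    rw [← sq_abs]
    gcongr
  gcongr

/-- The negative contribution of the balls is of order ε by the lower density, while the error is of
order ε⁴. For small ε the energy is negative on the whole N-dimensional family. -/
theorem exists_le_negSquares_of_lowerDensity {Φ : ℂ → ℂ} {b a : ℝ} {σ : Measure ℝ}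
    (hσ : Integrable (fun t : ℝ => 1 / (1 + t ^ 2)) σ)
    (hΦ : Set.EqOn Φ (nevFun b a σ) upperHP) {N : ℕ} {x : Fin N → ℝ}
    (hx : Function.Injective x) (hx0 : ∀ i, x i < 0)
    (hd : ∀ i, HasPositiveLowerDensity σ (x i)) :
    ∃ (k : ℕ) (z : Fin k → ℂ), Function.Injective z ∧ (∀ j, (z j).im ≠ 0) ∧
      N ≤ negSquares (pickMatrix (fun z => Φ z / z) z) := by
  have hδ : ∀ᶠ δ in 𝓝[>] (0 : ℝ), 0 < δ ∧ (∀ i j, i ≠ j → 2 * δ < |x i - x j|) ∧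
      ∀ i, x i ≤ -(2 * δ) := by
    refine eventually_mem_nhdsWithin.and (Filter.Eventually.filter_mono nhdsWithin_le_nhds
      (Eventually.and ?_ ?_))
    · rw [eventually_all]
      intro i
      rw [eventually_all]
      intro j
      by_cases hij : i = j
      · simp [hij]
      · have h1 : 0 < |x i - x j| := abs_pos.2 (sub_ne_zero.2 fun h => hij (hx h))
        have h2 : ContinuousAt (fun δ : ℝ => 2 * δ) 0 := by fun_prop
        filter_upwards [h2.eventually_lt (continuousAt_const (y := |x i - x j|)) (by simpa using h1)]
          with δ hδ _ using hδ
    · rw [eventually_all]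
      intro i
      have h2 : ContinuousAt (fun δ : ℝ => -(2 * δ)) 0 := by fun_prop
      filter_upwards [(continuousAt_const (y := x i)).eventually_lt h2 (by simpa using hx0 i)]
        with δ hδ using hδ.le
  obtain ⟨δ, hδ0, hsep, hneg⟩ := hδ.exists
  choose m hm hmr using hd
  -- From t² ≤ 2(t - x)² + 2x² and |t - x| ≥ δ; summing over i gives one constant for all points.
  let A : ℝ := ∑ i, ((1 + 2 * x i ^ 2) / δ ^ 2 + 2)
  have hA : ∀ i t, δ ≤ |t - x i| → 1 + t ^ 2 ≤ A * (t - x i) ^ 2 := by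
    intro i t ht
    have h1 : δ ^ 2 ≤ (t - x i) ^ 2 := by
      rw [← sq_abs (t - x i)]
      gcongr
    have h2 : (1 + 2 * x i ^ 2) / δ ^ 2 + 2 ≤ A :=
      Finset.single_le_sum (f := fun i => (1 + 2 * x i ^ 2) / δ ^ 2 + 2)
        (fun j _ => by positivity) (Finset.mem_univ i)
    have h3 : (1 + 2 * x i ^ 2) ≤ (1 + 2 * x i ^ 2) / δ ^ 2 * (t - x i) ^ 2 := by
      rw [div_mul_eq_mul_div, le_div_iff₀ (by positivity)]
      gcongr
    have h4 := mul_le_mul_of_nonneg_right h2 (sq_nonneg (t - x i))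
    nlinarith [sq_nonneg (t - 2 * x i)]
  set J := ∫ t : ℝ, 1 / (1 + t ^ 2) ∂σ
  have hε : ∀ᶠ ε in 𝓝[>] (0 : ℝ), 0 < ε ∧ ε ≤ δ ∧ (∀ i, ENNReal.ofReal (m i * ε) ≤
      σ (Metric.closedBall (x i) ε)) ∧ ∀ i, N * A ^ 2 * J * ε ^ 3 < δ / 8 * m i := by
    refine eventually_mem_nhdsWithin.and (Eventually.and ?_ (Eventually.and
      (eventually_all.2 hmr) (eventually_all.2 fun i => ?_)))
    · exact (eventually_le_nhds hδ0).filter_mono nhdsWithin_le_nhds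
    · have h2 : ContinuousAt (fun ε : ℝ => N * A ^ 2 * J * ε ^ 3) 0 := by fun_prop
      have h3 : 0 < δ / 8 * m i := mul_pos (by linarith) (hm i)
      exact (h2.eventually_lt continuousAt_const (by simpa using h3)).filter_mono
        nhdsWithin_le_nhds
  obtain ⟨ε, hε0, hεδ, hεm, hεJ⟩ := hε.exists
  have hN : N = Module.finrank ℂ (Fin N → ℂ) := by simp
  rw [hN]
  refine exists_le_negSquares hσ hΦ (poissonSystem x ε) (s := poissonPoints x ε)
    (fun z hz => im_ne_zero_of_mem_poissonPoints hε0.ne' hz) (poissonSystem_support x ε) ?_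
  intro c hc
  have hball : ∀ i, Integrable ((Metric.closedBall (x i) ε).indicator (1 : ℝ → ℝ)) σ := fun i => by
    rw [integrable_indicator_iff Metric.isClosed_closedBall.measurableSet]
    exact integrableOn_const (measure_closedBall_lt_top hσ _ _).ne
  set K := ∑ i, ‖c i‖ ^ 2
  have hi1 : Integrable (fun t => -(δ / 8 * ∑ i, ‖c i‖ ^ 2 *
      (Metric.closedBall (x i) ε).indicator (1 : ℝ → ℝ) t)) σ :=
    ((integrable_finsetSum _ fun i _ => (hball i).const_mul _).const_mul _).neg
  have hi2 : Integrable (fun t : ℝ => N * K * A ^ 2 * ε ^ 4 * (1 / (1 + t ^ 2))) σ :=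
    hσ.const_mul _
  have h1 : energy a σ (poissonSystem x ε c) ≤
      ∫ t, (-(δ / 8 * ∑ i, ‖c i‖ ^ 2 * (Metric.closedBall (x i) ε).indicator (1 : ℝ → ℝ) t) +
        N * K * A ^ 2 * ε ^ 4 * (1 / (1 + t ^ 2))) ∂σ := by
    have hi := integrable_energyDensity' hσ
      (fun z hz => im_ne_zero_of_mem_poissonPoints hε0.ne' hz) (poissonSystem_support x ε c)
    rw [totalWeight_poissonSystem] at hi
    rw [energy, totalWeight_poissonSystem]
    simp only [norm_zero, ne_eq, OfNat.ofNat_ne_zero, not_false_eq_true, zero_pow, mul_zero,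
      zero_add]
    refine integral_mono hi (hi1.add hi2) fun t => ?_
    have h := mul_norm_sum_bump_sq_le hδ0 hsep hneg hε0 hεδ hA c t
    simpa [energyDensity, cauchySum_poissonSystem x hε0.ne'] using h
  have h2 : ∀ i, m i * ε ≤ σ.real (Metric.closedBall (x i) ε) := fun i => by
    have := ENNReal.toReal_mono (measure_closedBall_lt_top hσ _ _).ne (hεm i)
    rwa [ENNReal.toReal_ofReal (mul_nonneg (hm i).le hε0.le)] at this
  rw [integral_add hi1 hi2, integral_neg, integral_const_mul, integral_const_mul,
    integral_finsetSum _ fun i _ => (hball i).const_mul _] at h1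
  simp only [integral_const_mul, integral_indicator_one
    (Metric.isClosed_closedBall (x := x _) (ε := ε)).measurableSet] at h1
  refine h1.trans_lt ?_
  obtain ⟨i0, hi0⟩ := Function.ne_iff.1 hc
  -- Since K = ∑ ‖c i‖², the error can be charged to the coefficients one at a time.
  have h3 : -(δ / 8 * ∑ i, ‖c i‖ ^ 2 * σ.real (Metric.closedBall (x i) ε)) +
      N * K * A ^ 2 * ε ^ 4 * J =
      ∑ i, ‖c i‖ ^ 2 * (N * A ^ 2 * J * ε ^ 3 * ε - δ / 8 * σ.real (Metric.closedBall (x i) ε)) := by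
    simp only [mul_sub, Finset.sum_sub_distrib, ← Finset.sum_mul, Finset.mul_sum]
    have : ∀ i, δ / 8 * (‖c i‖ ^ 2 * σ.real (Metric.closedBall (x i) ε)) =
      ‖c i‖ ^ 2 * (δ / 8 * σ.real (Metric.closedBall (x i) ε)) := fun i => by ring
    simp only [this]
    ring
  rw [h3]
  have h4 : ∀ i, N * A ^ 2 * J * ε ^ 3 * ε - δ / 8 * σ.real (Metric.closedBall (x i) ε) < 0 := by
    intro i
    nlinarith [mul_lt_mul_of_pos_right (hεJ i) hε0, h2 i]
  apply Finset.sum_neg'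
  · intro i _
    exact mul_nonpos_of_nonneg_of_nonpos (by positivity) (h4 i).le
  · refine ⟨i0, Finset.mem_univ _, mul_neg_of_pos_of_neg ?_ (h4 i0)⟩
    have : 0 < ‖c i0‖ := norm_pos_iff.2 hi0
    positivity

/-! ### The additional negative direction for a positive value at the origin -/

theorem energyDensity_smul (t : ℝ) (r F S : ℂ) :
    energyDensity t (r * F) (r * S) = ‖r‖ ^ 2 * energyDensity t F S := by
  have h : r * F * conj (r * S) = ((‖r‖ ^ 2 : ℝ) : ℂ) * (F * conj S) := by
    rw [map_mul]
    push_cast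
    rw [← Complex.mul_conj']
    ring
  rw [energyDensity, energyDensity, h, Complex.re_ofReal_mul, norm_mul, norm_mul]
  ring

theorem energy_smul (a : ℝ) (σ : Measure ℝ) (r : ℂ) (η : ℂ →₀ ℂ) :
    energy a σ (r • η) = ‖r‖ ^ 2 * energy a σ η := by
  simp only [energy, map_smul, smul_eq_mul, energyDensity_smul, integral_const_mul, norm_mul]
  ring

theorem energyDensity_add (t : ℝ) (F X S : ℂ) :
    energyDensity t (F + X) S =
      energyDensity t F S + t * (2 * (F * conj X).re + ‖X‖ ^ 2) - 2 * (X * conj S).re := by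
  have h : ‖F + X‖ ^ 2 = ‖F‖ ^ 2 + 2 * (F * conj X).re + ‖X‖ ^ 2 := by
    simp only [Complex.sq_norm, Complex.normSq_apply]
    simp
    ring
  rw [energyDensity, energyDensity, h, add_mul, Complex.add_re]
  ring

theorem abs_energyDensity_le (z c : ℂ) (t : ℝ) :
    |energyDensity t (c * ((t : ℂ) - z)⁻¹) c| ≤ ‖c‖ ^ 2 * ‖polKernel t z z‖ := by
  have h := sum_polKernel (k := 1) (fun _ => z) (fun _ => c) t
  rw [cauchySum_pointSystem, totalWeight_pointSystem] at h
  simp only [Finset.univ_unique, Finset.sum_singleton] at h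
  rw [← Real.norm_eq_abs, ← Complex.norm_real, ← h, norm_mul, norm_mul, RCLike.norm_conj]
  exact le_of_eq (by ring)

/-- The function `bump x ε` extended by continuity to `ε = 0`. -/
def bumpExt (x ε t : ℝ) : ℝ := if t = x then 1 else bump x ε t

theorem bumpExt_of_ne_zero (x : ℝ) {ε : ℝ} (hε : ε ≠ 0) (t : ℝ) : bumpExt x ε t = bump x ε t := by
  rw [bumpExt]
  split_ifs with h
  · subst h
    simp [bump, hε]
  · rfl

theorem bumpExt_zero (x t : ℝ) : bumpExt x 0 t = ({x} : Set ℝ).indicator 1 t := by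
  by_cases h : t = x <;> simp [bumpExt, bump, h]

theorem bumpExt_nonneg (x ε t : ℝ) : 0 ≤ bumpExt x ε t := by
  rw [bumpExt]
  split_ifs
  · exact zero_le_one
  · exact bump_nonneg x ε t

/-- The majorant does not depend on ε, which allows passage to ε = 0 under the integral. -/
theorem bumpExt_le {x ε : ℝ} (hε : |ε| ≤ 1) (t : ℝ) :
    bumpExt x ε t ≤ (3 + 2 * x ^ 2) * (1 / (1 + t ^ 2)) := by
  rw [mul_one_div, le_div_iff₀ (by positivity), bumpExt]
  have h1 : ε ^ 2 ≤ 1 := by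
    rw [← sq_abs]
    nlinarith [abs_nonneg ε]
  split_ifs with h
  · subst h
    nlinarith [sq_nonneg t]
  · have h2 : 0 < (t - x) ^ 2 := by
      have : t - x ≠ 0 := sub_ne_zero.2 h
      positivity
    rw [bump, div_mul_eq_mul_div, div_le_iff₀ (by positivity)]
    have h3 : 1 + t ^ 2 ≤ 1 + 2 * x ^ 2 + 2 * (t - x) ^ 2 := by nlinarith [sq_nonneg (t - 2 * x)]
    nlinarith [mul_le_mul_of_nonneg_left h3 (sq_nonneg ε), sq_nonneg x, sq_nonneg ε,
      mul_nonneg (sq_nonneg x) (sq_nonneg ε), mul_nonneg (sq_nonneg x) h2.le]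

theorem continuous_bumpExt (x t : ℝ) : Continuous fun ε => bumpExt x ε t := by
  by_cases h : t = x
  · simp [bumpExt, h, continuous_const]
  · simp only [bumpExt, h, if_false, bump]
    have h2 : 0 < (t - x) ^ 2 := by
      have : t - x ≠ 0 := sub_ne_zero.2 h
      positivity
    exact Continuous.div (by fun_prop) (by fun_prop) fun ε => by positivity

theorem measurable_bumpExt (x ε : ℝ) : Measurable (bumpExt x ε) := by
  unfold bumpExt
  refine Measurable.ite (measurableSet_singleton x) measurable_const ?_
  unfold bump
  fun_prop

section PositiveValue

variable {n : ℕ} (z₀ : ℂ) (p : Fin n → ℝ)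

/-- The combination of the weighted point `z₀` and of `poissonSystem p ε`. -/
def extendedSystem (ε : ℝ) : ℂ × (Fin n → ℂ) →ₗ[ℂ] (ℂ →₀ ℂ) :=
  (Finsupp.lsingle z₀).coprod (poissonSystem p ε)

/-- The Cauchy sum of `extendedSystem z₀ p ε d`, extended to `ε = 0`. -/
def extendedCauchy (d : ℂ × (Fin n → ℂ)) (ε t : ℝ) : ℂ :=
  d.1 * ((t : ℂ) - z₀)⁻¹ + ∑ i, d.2 i * (bumpExt (p i) ε t : ℂ)

theorem totalWeight_extendedSystem (ε : ℝ) (d : ℂ × (Fin n → ℂ)) :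
    totalWeight (extendedSystem z₀ p ε d) = d.1 := by
  rw [extendedSystem, LinearMap.coprod_apply, map_add, totalWeight_poissonSystem]
  simp [totalWeight]

theorem cauchySum_extendedSystem {ε : ℝ} (hε : ε ≠ 0) (d : ℂ × (Fin n → ℂ)) (t : ℝ) :
    cauchySum t (extendedSystem z₀ p ε d) = extendedCauchy z₀ p d ε t := by
  rw [extendedSystem, LinearMap.coprod_apply, map_add, cauchySum_poissonSystem p hε]
  simp [cauchySum, extendedCauchy, bumpExt_of_ne_zero _ hε]

theorem extendedSystem_support (ε : ℝ) (d : ℂ × (Fin n → ℂ)) :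
    (extendedSystem z₀ p ε d).support ⊆ insert z₀ (poissonPoints p ε) := by
  rw [extendedSystem, LinearMap.coprod_apply]
  refine Finsupp.support_add.trans (Finset.union_subset ?_ ?_)
  · exact Finsupp.support_single_subset.trans (by simp)
  · exact (poissonSystem_support p ε d.2).trans (Finset.subset_insert _ _)

variable {z₀}

/-- Expansion about the one-point system at z₀: its own density is controlled by `polKernel`, and in
the mixed terms tF is bounded while the bump part X is O(1/(1 + t²)). The bound is uniform over the
unit ball of weights and |ε| ≤ 1. -/
theorem exists_abs_energyDensity_extendedCauchy_le (hz₀ : z₀.im ≠ 0) :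
    ∃ C : ℝ, ∀ (d : ℂ × (Fin n → ℂ)) (ε t : ℝ), ‖d‖ ≤ 1 → |ε| ≤ 1 →
      |energyDensity t (extendedCauchy z₀ p d ε t) d.1| ≤ C * (1 / (1 + t ^ 2)) := by
  obtain ⟨P, hP⟩ : ∃ P : ℝ, ∀ t, ‖polKernel t z₀ z₀‖ ≤ P * (1 / (1 + t ^ 2)) :=
    ⟨_, norm_polKernel_le hz₀ hz₀⟩
  let M := 1 + (1 + ‖z₀‖) / |z₀.im|
  let B := ∑ i, (3 + 2 * p i ^ 2)
  refine ⟨P + 2 * M * B + B ^ 2 + 2 * B, fun d ε t hd hε => ?_⟩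
  have hd1 : ‖d.1‖ ≤ 1 := (norm_fst_le d).trans hd
  have hd2 : ∀ i, ‖d.2 i‖ ≤ 1 := fun i => (norm_le_pi_norm d.2 i).trans ((norm_snd_le d).trans hd)
  have hB0 : 0 ≤ B := Finset.sum_nonneg fun i _ => by positivity
  have hM0 : 0 ≤ M := by positivity
  set q := 1 / (1 + t ^ 2) with hq
  have hq0 : 0 < q := by positivity
  set X := ∑ i, d.2 i * (bumpExt (p i) ε t : ℂ) with hX
  set F := d.1 * ((t : ℂ) - z₀)⁻¹ with hF
  have hXle : ‖X‖ ≤ B * q := by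
    refine (norm_sum_le _ _).trans ?_
    rw [Finset.sum_mul]
    refine Finset.sum_le_sum fun i _ => ?_
    rw [norm_mul, Complex.norm_real, Real.norm_of_nonneg (bumpExt_nonneg _ _ _)]
    calc _ ≤ 1 * bumpExt (p i) ε t := by
          gcongr
          · exact bumpExt_nonneg _ _ _
          · exact hd2 i
      _ ≤ _ := by
          rw [one_mul]
          exact bumpExt_le hε t
  have hFle : |t| * ‖F‖ ≤ M := by
    have h1 := one_add_abs_le hz₀ t
    have h2 : 0 < ‖(t : ℂ) - z₀‖ := norm_pos_iff.2 (ofReal_sub_ne_zero hz₀ t)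
    rw [hF, norm_mul, norm_inv, ← div_eq_mul_inv, mul_div_assoc', div_le_iff₀ h2]
    refine le_trans ?_ h1
    nlinarith [abs_nonneg t, norm_nonneg d.1]
  have h1 : |energyDensity t F d.1| ≤ P * q := by
    refine (abs_energyDensity_le z₀ d.1 t).trans ?_
    have h2 : ‖d.1‖ ^ 2 ≤ 1 := pow_le_one₀ (norm_nonneg _) hd1
    calc _ ≤ 1 * ‖polKernel t z₀ z₀‖ := by gcongr
      _ ≤ _ := by
        rw [one_mul]
        exact hP t
  have h2 : |t * (2 * (F * conj X).re)| ≤ 2 * M * B * q := by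
    have h3 : |(F * conj X).re| ≤ ‖F‖ * ‖X‖ := by
      have := Complex.abs_re_le_norm (F * conj X)
      rwa [norm_mul, RCLike.norm_conj] at this
    rw [abs_mul, abs_mul, abs_two]
    calc _ ≤ |t| * (2 * (‖F‖ * ‖X‖)) := by gcongr
      _ = 2 * (|t| * ‖F‖) * ‖X‖ := by ring
      _ ≤ 2 * M * (B * q) := by gcongr
      _ = _ := by ring
  have h3 : |t * ‖X‖ ^ 2| ≤ B ^ 2 * q := by
    have h4 : |t| ≤ 1 + t ^ 2 := by
      rw [← sq_abs]
      nlinarith [abs_nonneg t, sq_nonneg (|t| - 1)]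
    rw [abs_mul, abs_of_nonneg (sq_nonneg ‖X‖)]
    calc _ ≤ (1 + t ^ 2) * (B * q) ^ 2 := by gcongr
      _ = _ := by
        rw [hq]
        field_simp
  have h4 : |2 * (X * conj d.1).re| ≤ 2 * B * q := by
    have h5 : |(X * conj d.1).re| ≤ ‖X‖ * ‖d.1‖ := by
      have := Complex.abs_re_le_norm (X * conj d.1)
      rwa [norm_mul, RCLike.norm_conj] at this
    rw [abs_mul, abs_two]
    calc _ ≤ 2 * (‖X‖ * ‖d.1‖) := by gcongr
      _ ≤ 2 * (B * q * 1) := by gcongr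
      _ = _ := by ring
  rw [extendedCauchy, energyDensity_add, mul_add]
  rw [abs_le] at *
  constructor <;> nlinarith

theorem measurable_energyDensity_extendedCauchy (d : ℂ × (Fin n → ℂ)) (ε : ℝ) :
    Measurable fun t => energyDensity t (extendedCauchy z₀ p d ε t) d.1 := by
  have h1 : Measurable (extendedCauchy z₀ p d ε) := by
    unfold extendedCauchy
    refine Measurable.add (by fun_prop) (Finset.measurable_fun_sum _ fun i _ => ?_)
    exact (Complex.measurable_ofReal.comp (measurable_bumpExt (p i) ε)).const_mul _
  unfold energyDensity
  have h2 : Measurable fun t => (extendedCauchy z₀ p d ε t * conj d.1).re :=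
    Complex.measurable_re.comp (h1.mul_const _)
  have h3 : Measurable fun t => ‖extendedCauchy z₀ p d ε t‖ := h1.norm
  fun_prop

variable (z₀) in
/-- The energy of `extendedSystem z₀ p ε d`, extended to `ε = 0`. -/
def extendedEnergy (a : ℝ) (σ : Measure ℝ) (x : (ℂ × (Fin n → ℂ)) × ℝ) : ℝ :=
  -a * ‖x.1.1‖ ^ 2 + ∫ t, energyDensity t (extendedCauchy z₀ p x.1 x.2 t) x.1.1 ∂σ

theorem continuousOn_extendedEnergy (hz₀ : z₀.im ≠ 0) (a : ℝ) {σ : Measure ℝ}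
    (hσ : Integrable (fun t : ℝ => 1 / (1 + t ^ 2)) σ) :
    ContinuousOn (extendedEnergy z₀ p a σ) (Metric.sphere 0 1 ×ˢ Set.Icc 0 1) := by
  obtain ⟨C, hC⟩ := exists_abs_energyDensity_extendedCauchy_le p hz₀
  refine ContinuousOn.add (by fun_prop)
    (continuousOn_of_dominated (bound := fun t => C * (1 / (1 + t ^ 2))) ?_ ?_ (hσ.const_mul C) ?_)
  · exact fun x _ => (measurable_energyDensity_extendedCauchy p x.1 x.2).aestronglyMeasurable
  · rintro x ⟨hx1, hx2⟩
    filter_upwards with t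
    refine hC x.1 x.2 t (by simpa using hx1.le) ?_
    rw [abs_of_nonneg hx2.1]
    exact hx2.2
  · filter_upwards with t
    apply Continuous.continuousOn
    have h1 : ∀ i, Continuous fun x : (ℂ × (Fin n → ℂ)) × ℝ => bumpExt (p i) x.2 t := fun i =>
      (continuous_bumpExt (p i) t).comp continuous_snd
    have h2 : Continuous fun x : (ℂ × (Fin n → ℂ)) × ℝ => extendedCauchy z₀ p x.1 x.2 t := by
      unfold extendedCauchy
      refine Continuous.add (by fun_prop) (continuous_finsetSum _ fun i _ => ?_)
      exact Continuous.mul (by fun_prop) (Complex.continuous_ofReal.comp (h1 i))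
    unfold energyDensity
    have h3 : Continuous fun x : (ℂ × (Fin n → ℂ)) × ℝ =>
        (extendedCauchy z₀ p x.1 x.2 t * conj x.1.1).re :=
      Complex.continuous_re.comp (h2.mul (Complex.continuous_conj.comp (by fun_prop)))
    fun_prop

/-- The function whose integral, added to `a`, approximates `Φ(0-)`. -/
def valueDensity (s t : ℝ) : ℝ :=
  if t < 0 then 1 / (t + t ^ 3) else 1 / (t + s) - t / (1 + t ^ 2)

/-- At ε = 0 the bumps are indicators of the poles. They are invisible for t ≥ 0, and at a pole they
make the value of F adjustable, so completing the square there gives equality. -/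
theorem energyDensity_extendedCauchy_zero_le {s : ℝ} (hs : 0 < s) (hp : Function.Injective p)
    (hp0 : ∀ i, p i < 0) (d : ℂ × (Fin n → ℂ)) {t : ℝ} (ht : 0 ≤ t ∨ ∃ j, t = p j) :
    energyDensity t (extendedCauchy (-s + s * Complex.I) p d 0 t) d.1 ≤
      -(‖d.1‖ ^ 2 * valueDensity s t) - ∑ i, ({p i} : Set ℝ).indicator 1 t *
        ((-p i)⁻¹ * ‖p i * (d.1 * ((p i : ℂ) - (-s + s * Complex.I))⁻¹ + d.2 i) - d.1‖ ^ 2) := by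
  simp only [extendedCauchy, bumpExt_zero]
  rcases ht with ht | ⟨j, rfl⟩
  · have h0 : ∀ i, ({p i} : Set ℝ).indicator (1 : ℝ → ℝ) t = 0 := fun i => by
      apply Set.indicator_of_notMem
      intro h
      rw [Set.mem_singleton_iff] at h
      linarith [hp0 i]
    simp only [h0, Complex.ofReal_zero, mul_zero, Finset.sum_const_zero, add_zero, zero_mul,
      sub_zero, valueDensity, not_lt.2 ht, if_false]
    have h1 := energyDensity_smul t d.1 ((t : ℂ) - (-s + s * Complex.I))⁻¹ 1
    rw [mul_one] at h1
    rw [h1, ← mul_neg]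
    gcongr
    have hpos : 0 < (t + s) ^ 2 + s ^ 2 := by positivity
    have h2 : Complex.normSq ((t : ℂ) - (-s + s * Complex.I)) = (t + s) ^ 2 + s ^ 2 := by
      rw [Complex.normSq_apply]
      simp
      ring
    have h3 : ((t : ℂ) - (-s + s * Complex.I))⁻¹.re = (t + s) / ((t + s) ^ 2 + s ^ 2) := by
      rw [Complex.inv_re, h2]
      simp
    have h4 : ‖((t : ℂ) - (-s + s * Complex.I))⁻¹‖ ^ 2 = 1 / ((t + s) ^ 2 + s ^ 2) := by
      rw [norm_inv, inv_pow, Complex.sq_norm, h2, one_div]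
    simp only [energyDensity, map_one, mul_one, norm_one, one_pow]
    rw [h3, h4]
    -- After cross-multiplication the difference is st ≥ 0. The non-real point -s + is thus at least
    -- as good as the boundary value at -s.
    have h5 : 1 / (t + s) ≤ (t + 2 * s) / ((t + s) ^ 2 + s ^ 2) := by
      rw [div_le_div_iff₀ (by positivity) hpos]
      nlinarith [mul_nonneg hs.le ht]
    have h6 : t * (1 / ((t + s) ^ 2 + s ^ 2)) - 2 * ((t + s) / ((t + s) ^ 2 + s ^ 2)) =
        -((t + 2 * s) / ((t + s) ^ 2 + s ^ 2)) := by
      field_simp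
      ring
    linarith
  · have h0 : ∀ i, i ≠ j → ({p i} : Set ℝ).indicator (1 : ℝ → ℝ) (p j) = 0 := fun i hi => by
      apply Set.indicator_of_notMem
      intro h
      exact hi (hp h).symm
    have h1 : ({p j} : Set ℝ).indicator (1 : ℝ → ℝ) (p j) = 1 := by simp
    rw [Finset.sum_eq_single j (fun i _ hi => by simp [h0 i hi]) (by simp),
      Finset.sum_eq_single j (fun i _ hi => by simp [h0 i hi]) (by simp), h1,
      energyDensity_eq (hp0 j).ne, valueDensity, if_pos (hp0 j)]
    simp only [Complex.ofReal_one, mul_one]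
    rw [inv_neg]
    apply le_of_eq
    ring

/-- The limit energy at ε = 0 is negative on the unit sphere, though no actual system realizes ε =
0. Joint continuity and compactness give negativity for some ε > 0, and homogeneity extends it to
all nonzero weights. -/
theorem exists_add_one_le_negSquares {Φ : ℂ → ℂ} {b a : ℝ} {σ : Measure ℝ}
    (hσ : Integrable (fun t : ℝ => 1 / (1 + t ^ 2)) σ)
    (hΦ : Set.EqOn Φ (nevFun b a σ) upperHP) {p : Fin n → ℝ} (hp : Function.Injective p)
    (hp0 : ∀ i, p i < 0) (hpos : ∀ i, σ {p i} ≠ 0) (hae : ∀ᵐ t ∂σ, 0 ≤ t ∨ ∃ j, t = p j)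
    {s : ℝ} (hs : 0 < s) (hint : Integrable (valueDensity s) σ)
    (hval : 0 < a + ∫ t, valueDensity s t ∂σ) :
    ∃ (k : ℕ) (z : Fin k → ℂ), Function.Injective z ∧ (∀ j, (z j).im ≠ 0) ∧
      n + 1 ≤ negSquares (pickMatrix (fun z => Φ z / z) z) := by
  let z₀ : ℂ := -s + s * Complex.I
  have hz₀ : z₀.im ≠ 0 := by simp [z₀, hs.ne']
  have hcont := continuousOn_extendedEnergy p hz₀ a hσ
  have hfin : ∀ x, σ {x} ≠ ⊤ := fun x => by
    have := (measure_closedBall_lt_top hσ x 0).ne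
    rwa [Metric.closedBall_zero] at this
  have hneg0 : ∀ d ∈ Metric.sphere (0 : ℂ × (Fin n → ℂ)) 1, extendedEnergy z₀ p a σ (d, 0) < 0 := by
    intro d hd
    let w : Fin n → ℝ := fun i =>
      (-p i)⁻¹ * ‖p i * (d.1 * ((p i : ℂ) - z₀)⁻¹ + d.2 i) - d.1‖ ^ 2
    have hw0 : ∀ i, 0 ≤ w i := fun i =>
      mul_nonneg (inv_nonneg.2 (by linarith [hp0 i])) (sq_nonneg _)
    have hind : ∀ i, Integrable (({p i} : Set ℝ).indicator (1 : ℝ → ℝ)) σ := fun i => by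
      rw [integrable_indicator_iff (measurableSet_singleton _)]
      exact integrableOn_const (hfin _)
    have hi1 : Integrable (fun t => -(‖d.1‖ ^ 2 * valueDensity s t)) σ := (hint.const_mul _).neg
    have hi2 : Integrable (fun t => ∑ i, ({p i} : Set ℝ).indicator (1 : ℝ → ℝ) t * w i) σ :=
      integrable_finsetSum _ fun i _ => (hind i).mul_const _
    obtain ⟨C, hC⟩ := exists_abs_energyDensity_extendedCauchy_le p hz₀
    have hi : Integrable (fun t => energyDensity t (extendedCauchy z₀ p d 0 t) d.1) σ :=
      (hσ.const_mul C).mono' (measurable_energyDensity_extendedCauchy p d 0).aestronglyMeasurable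
        (Eventually.of_forall fun t => hC d 0 t (by simpa using hd.le) (by simp))
    have h1 : ∫ t, energyDensity t (extendedCauchy z₀ p d 0 t) d.1 ∂σ ≤
        ∫ t, (-(‖d.1‖ ^ 2 * valueDensity s t) -
          ∑ i, ({p i} : Set ℝ).indicator (1 : ℝ → ℝ) t * w i) ∂σ := by
      apply integral_mono_ae hi (hi1.sub hi2)
      filter_upwards [hae] with t ht
      exact energyDensity_extendedCauchy_zero_le p hs hp hp0 d ht
    rw [integral_sub hi1 hi2, integral_neg, integral_const_mul,
      integral_finsetSum _ fun i _ => (hind i).mul_const _] at h1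
    simp only [integral_mul_const, integral_indicator_one (measurableSet_singleton _)] at h1
    have h2 : ∀ i, 0 ≤ σ.real {p i} * w i := fun i => mul_nonneg measureReal_nonneg (hw0 i)
    have h3 := Finset.sum_nonneg fun i (_ : i ∈ Finset.univ) => h2 i
    simp only [extendedEnergy]
    -- If d.1 = 0, some d.2 i is nonzero and the positive mass at p i makes the energy negative;
    -- otherwise `hval` does.
    by_cases hd1 : d.1 = 0
    · obtain ⟨i, hdi⟩ : ∃ i, d.2 i ≠ 0 := by
        by_contra! h
        have : d = 0 := Prod.ext hd1 (funext h)
        simp [this] at hd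
      have h4 : 0 < σ.real {p i} * w i := by
        apply mul_pos
        · exact ENNReal.toReal_pos (hpos i) (hfin _)
        · apply mul_pos (inv_pos.2 (by linarith [hp0 i]))
          have : (p i : ℂ) ≠ 0 := by exact_mod_cast (hp0 i).ne
          have : 0 < ‖(p i : ℂ) * (d.1 * ((p i : ℂ) - z₀)⁻¹ + d.2 i) - d.1‖ := by
            rw [norm_pos_iff, hd1]
            simp [this, hdi]
          positivity
      have h5 := Finset.sum_pos' (fun i (_ : i ∈ Finset.univ) => h2 i) ⟨i, Finset.mem_univ _, h4⟩
      rw [hd1] at h1 ⊢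
      simp only [norm_zero] at h1 ⊢
      nlinarith
    · have : 0 < ‖d.1‖ := norm_pos_iff.2 hd1
      nlinarith [mul_pos (pow_pos this 2) hval]
  have hK : IsCompact (Metric.sphere (0 : ℂ × (Fin n → ℂ)) 1 ×ˢ Set.Icc (0 : ℝ) 1) :=
    (isCompact_sphere _ _).prod isCompact_Icc
  -- The set of ε for which some unit vector has nonnegative energy is compact and misses 0, so it
  -- misses a neighbourhood of 0.
  have hbad : IsCompact (Prod.snd '' ((Metric.sphere (0 : ℂ × (Fin n → ℂ)) 1 ×ˢ
      Set.Icc (0 : ℝ) 1) ∩ extendedEnergy z₀ p a σ ⁻¹' Set.Ici 0)) :=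
    (hK.of_isClosed_subset (hcont.preimage_isClosed_of_isClosed hK.isClosed isClosed_Ici)
      Set.inter_subset_left).image continuous_snd
  have h0 : (0 : ℝ) ∉ Prod.snd '' ((Metric.sphere (0 : ℂ × (Fin n → ℂ)) 1 ×ˢ
      Set.Icc (0 : ℝ) 1) ∩ extendedEnergy z₀ p a σ ⁻¹' Set.Ici 0) := by
    rintro ⟨⟨d, ε⟩, ⟨⟨hd, -⟩, hE⟩, rfl⟩
    exact absurd (hneg0 d hd) (not_lt.2 hE)
  have hev : ∀ᶠ ε in 𝓝[>] (0 : ℝ), ε ∈ Set.Ioc 0 1 ∧ ε ∉ Prod.snd ''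
      ((Metric.sphere (0 : ℂ × (Fin n → ℂ)) 1 ×ˢ
      Set.Icc (0 : ℝ) 1) ∩ extendedEnergy z₀ p a σ ⁻¹' Set.Ici 0) :=
    Filter.inter_mem (Ioc_mem_nhdsGT one_pos)
      (nhdsWithin_le_nhds (hbad.isClosed.isOpen_compl.mem_nhds h0))
  obtain ⟨ε, ⟨hε0, hε1⟩, hε⟩ := hev.exists
  have hfr : n + 1 = Module.finrank ℂ (ℂ × (Fin n → ℂ)) := by
    simp [add_comm]
  rw [hfr]
  refine exists_le_negSquares hσ hΦ (extendedSystem z₀ p ε)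
    (s := insert z₀ (poissonPoints p ε)) ?_ (extendedSystem_support z₀ p ε) ?_
  · intro z hz
    rcases Finset.mem_insert.1 hz with rfl | hz
    · exact hz₀
    · exact im_ne_zero_of_mem_poissonPoints hε0.ne' hz
  · intro d hd
    have hd0 : 0 < ‖d‖ := norm_pos_iff.2 hd
    have hd1 : (((‖d‖⁻¹ : ℝ) : ℂ) • d) ∈ Metric.sphere (0 : ℂ × (Fin n → ℂ)) 1 := by
      rw [mem_sphere_zero_iff_norm, norm_smul, Complex.norm_real, norm_inv, norm_norm,
        inv_mul_cancel₀ hd0.ne']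
    have h1 : energy a σ (extendedSystem z₀ p ε (((‖d‖⁻¹ : ℝ) : ℂ) • d)) < 0 := by
      by_contra hcon
      refine hε ⟨(_, ε), ⟨⟨hd1, hε0.le, hε1⟩, ?_⟩, rfl⟩
      rw [not_lt, energy] at hcon
      simp only [totalWeight_extendedSystem, cauchySum_extendedSystem _ _ hε0.ne'] at hcon
      exact hcon
    rw [map_smul, energy_smul] at h1
    by_contra hcon
    exact absurd h1 (not_lt.2 (mul_nonneg (sq_nonneg _) (not_lt.1 hcon)))

end PositiveValue

/-! ### The value at the origin -/

section ValueZero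

variable {τ : Measure ℝ}

/-- Unlike `norm_nevKernel_le`, this bound survives Im z → 0, as needed for boundary values on the
negative half-line. -/
theorem norm_nevKernel_le_of_re_neg {z : ℂ} {t : ℝ} (hz : z.re < 0) (ht : 0 ≤ t) :
    ‖nevKernel t z‖ ≤ ((-z.re)⁻¹ + ‖z‖) * (1 / (1 + t ^ 2)) := by
  have h1 : t - z.re ≤ ‖(t : ℂ) - z‖ := by
    refine (le_abs_self _).trans ?_
    simpa using Complex.abs_re_le_norm ((t : ℂ) - z)
  have h2 : 0 < t - z.re := by linarith
  have h3 : ‖(1 + (t : ℂ) ^ 2)‖ = 1 + t ^ 2 := by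
    have : (1 + (t : ℂ) ^ 2) = ((1 + t ^ 2 : ℝ) : ℂ) := by push_cast; ring
    rw [this, Complex.norm_real, Real.norm_of_nonneg (by positivity)]
  have h4 : ‖1 + t * z‖ ≤ 1 + t * ‖z‖ := by
    have := norm_add_le (1 : ℂ) (t * z)
    rwa [norm_mul, Complex.norm_real, Real.norm_of_nonneg ht, norm_one] at this
  have h5 : 0 < ‖(t : ℂ) - z‖ := h2.trans_le h1
  rw [nevKernel_eq (norm_pos_iff.1 h5), norm_div, norm_mul, h3, ← div_div, mul_one_div]
  gcongr
  rw [div_le_iff₀ h5]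
  have h6 : 0 < (-z.re)⁻¹ := inv_pos.2 (by linarith)
  have h7 : (-z.re)⁻¹ * (-z.re) = 1 := inv_mul_cancel₀ (by linarith)
  calc _ ≤ 1 + t * ‖z‖ := h4
    _ ≤ ((-z.re)⁻¹ + ‖z‖) * (t - z.re) := by
        nlinarith [mul_nonneg h6.le ht, mul_nonneg (norm_nonneg z) (by linarith : 0 ≤ -z.re)]
    _ ≤ _ := by gcongr

theorem ofReal_re_nevKernel (t x : ℝ) :
    nevKernel t x = ((1 / (t - x) - t / (1 + t ^ 2) : ℝ) : ℂ) := by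
  rw [nevKernel]
  push_cast
  ring

theorem integrable_nevKernel_of_neg (hτ : Integrable (fun t : ℝ => 1 / (1 + t ^ 2)) τ)
    (hpos : ∀ᵐ t ∂τ, 0 ≤ t) {x : ℝ} (hx : x < 0) :
    Integrable (fun t => 1 / (t - x) - t / (1 + t ^ 2)) τ := by
  refine (hτ.const_mul ((-x)⁻¹ + |x|)).mono'
    (by fun_prop : Measurable _).aestronglyMeasurable ?_
  filter_upwards [hpos] with t ht
  have := norm_nevKernel_le_of_re_neg (z := (x : ℂ)) (by simpa using hx) ht
  rwa [ofReal_re_nevKernel, Complex.norm_real, Complex.norm_real, Complex.ofReal_re,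
    Real.norm_eq_abs x] at this

theorem tendsto_integral_nevKernel (hτ : Integrable (fun t : ℝ => 1 / (1 + t ^ 2)) τ)
    (hpos : ∀ᵐ t ∂τ, 0 ≤ t) {x : ℝ} (hx : x < 0) :
    Tendsto (fun y : ℝ => ∫ t, nevKernel t (x + y * Complex.I) ∂τ) (𝓝[>] 0)
      (𝓝 ((∫ t, (1 / (t - x) - t / (1 + t ^ 2)) ∂τ : ℝ) : ℂ)) := by
  rw [← integral_complex_ofReal]
  apply tendsto_integral_filter_of_dominated_convergence
    (fun t => ((-x)⁻¹ + (|x| + 1)) * (1 / (1 + t ^ 2)))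
  · exact Eventually.of_forall fun y => (measurable_nevKernel _).aestronglyMeasurable
  · filter_upwards [Ioc_mem_nhdsGT one_pos] with y hy
    filter_upwards [hpos] with t ht
    have h1 := norm_nevKernel_le_of_re_neg (z := (x : ℂ) + y * Complex.I) (by simpa using hx) ht
    have h2 : ‖(x : ℂ) + y * Complex.I‖ ≤ |x| + 1 := by
      refine (norm_add_le _ _).trans ?_
      simp only [Complex.norm_real, norm_mul, Complex.norm_I, mul_one, Real.norm_eq_abs]
      rw [abs_of_pos hy.1]
      linarith [hy.2]
    refine h1.trans ?_
    simp only [Complex.add_re, Complex.ofReal_re, Complex.mul_re, Complex.I_re, mul_zero,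
      Complex.ofReal_im, Complex.I_im, mul_one, sub_self, add_zero]
    gcongr
  · exact hτ.const_mul _
  · filter_upwards [hpos] with t ht
    rw [← ofReal_re_nevKernel]
    have h1 : ContinuousAt (fun y : ℝ => nevKernel t (x + y * Complex.I)) 0 := by
      have h2 : ContinuousAt (fun y : ℝ => ((t : ℂ) - (x + y * Complex.I))⁻¹) 0 := by
        apply ContinuousAt.inv₀ (by fun_prop)
        simp only [Complex.ofReal_zero, zero_mul, add_zero]
        exact_mod_cast (by linarith : 0 < t - x).ne'
      simp only [nevKernel, one_div]
      fun_prop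
    have h3 := h1.tendsto.mono_left (nhdsWithin_le_nhds (s := Set.Ioi 0))
    simpa using h3

/-- For x < 0 ≤ t the integrand is at most its limit, which bounds the limsup; Fatou bounds the
liminf. An infinite limit is allowed. -/
theorem tendsto_lintegral_inv (hpos : ∀ᵐ t ∂τ, 0 ≤ t) :
    Tendsto (fun x : ℝ => ∫⁻ t, (ENNReal.ofReal ((t - x) * (1 + t ^ 2)))⁻¹ ∂τ) (𝓝[<] 0)
      (𝓝 (∫⁻ t, (ENNReal.ofReal (t + t ^ 3))⁻¹ ∂τ)) := by
  have hlim : ∀ t : ℝ, Tendsto (fun x : ℝ => (ENNReal.ofReal ((t - x) * (1 + t ^ 2)))⁻¹) (𝓝[<] 0)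
      (𝓝 ((ENNReal.ofReal (t + t ^ 3))⁻¹)) := by
    intro t
    have h1 : Continuous fun x : ℝ => (ENNReal.ofReal ((t - x) * (1 + t ^ 2)))⁻¹ :=
      (ENNReal.continuous_ofReal.comp (by fun_prop)).inv
    have h2 := (h1.tendsto 0).mono_left (nhdsWithin_le_nhds (s := Set.Iio 0))
    have h3 : (t - 0) * (1 + t ^ 2) = t + t ^ 3 := by ring
    rwa [h3] at h2
  refine tendsto_of_le_liminf_of_limsup_le ?_ ?_
  · refine le_trans ?_ (lintegral_liminf_le fun x => by fun_prop)
    exact lintegral_mono fun t => (hlim t).liminf_eq.ge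
  · apply limsup_le_of_le
    · isBoundedDefault
    · filter_upwards [self_mem_nhdsWithin] with x hx
      apply lintegral_mono_ae
      filter_upwards [hpos] with t ht
      have hx' : x < 0 := hx
      gcongr
      nlinarith [sq_nonneg t]

/-- The integrand splits as 1/((t-x)(1+t²)) + xt/((t-x)(1+t²)). The first part is nonnegative and
covered by `tendsto_lintegral_inv`; the second is at most |x|/(1+t²) in absolute value and vanishes
in the limit. -/
theorem tendsto_ereal_integral_nevKernel (hτ : Integrable (fun t : ℝ => 1 / (1 + t ^ 2)) τ)
    (hpos : ∀ᵐ t ∂τ, 0 ≤ t) (v : ℝ) :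
    Tendsto (fun x : ℝ => ((v + ∫ t, (1 / (t - x) - t / (1 + t ^ 2)) ∂τ : ℝ) : EReal)) (𝓝[<] 0)
      (𝓝 ((v : EReal) + ((∫⁻ t, (ENNReal.ofReal (t + t ^ 3))⁻¹ ∂τ : ENNReal) : EReal))) := by
  set J := ∫ t : ℝ, 1 / (1 + t ^ 2) ∂τ
  have hrest : ∀ x < (0 : ℝ), ∀ t : ℝ, 0 ≤ t → |x * t / ((t - x) * (1 + t ^ 2))| ≤ |x| * (1 / (1 + t ^ 2)) := by
    intro x hx t ht
    have h1 : 0 < t - x := by linarith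
    rw [abs_div, abs_mul, abs_of_nonneg ht, abs_of_pos (by positivity : 0 < (t - x) * (1 + t ^ 2)),
      mul_one_div, ← div_div]
    gcongr
    rw [div_le_iff₀ h1]
    gcongr
    linarith
  have hri : ∀ x < (0 : ℝ), Integrable (fun t : ℝ => x * t / ((t - x) * (1 + t ^ 2))) τ := fun x hx => by
    refine (hτ.const_mul |x|).mono'
      (by fun_prop : Measurable _).aestronglyMeasurable ?_
    filter_upwards [hpos] with t ht
    exact hrest x hx t ht
  have hr : Tendsto (fun x : ℝ => v + ∫ t, x * t / ((t - x) * (1 + t ^ 2)) ∂τ) (𝓝[<] 0) (𝓝 v) := by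
    have h1 : Tendsto (fun x : ℝ => ∫ t, x * t / ((t - x) * (1 + t ^ 2)) ∂τ) (𝓝[<] 0) (𝓝 0) := by
      apply squeeze_zero_norm' (a := fun x => |x| * J)
      · filter_upwards [self_mem_nhdsWithin] with x hx
        rw [← integral_const_mul]
        apply norm_integral_le_of_norm_le (hτ.const_mul |x|)
        filter_upwards [hpos] with t ht
        exact hrest x hx t ht
      · have h2 : Continuous fun x : ℝ => |x| * J := by fun_prop
        have h3 := (h2.tendsto 0).mono_left (nhdsWithin_le_nhds (s := Set.Iio 0))
        simpa using h3
    simpa using h1.const_add v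
  have hA := (EReal.tendsto_coe_ennreal.2 (tendsto_lintegral_inv hpos))
  have hv := EReal.tendsto_coe.2 hr
  have hsum := (EReal.continuousAt_add (p := ((v : EReal),
    ((∫⁻ t, (ENNReal.ofReal (t + t ^ 3))⁻¹ ∂τ : ENNReal) : EReal))) (Or.inl (EReal.coe_ne_top v))
    (Or.inl (EReal.coe_ne_bot v))).tendsto.comp (hv.prodMk_nhds hA)
  refine hsum.congr' ?_
  filter_upwards [self_mem_nhdsWithin] with x hx
  have hx' : x < 0 := hx
  have hfi : Integrable (fun t => 1 / ((t - x) * (1 + t ^ 2))) τ := by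
    refine ((integrable_nevKernel_of_neg hτ hpos hx').sub (hri x hx')).congr ?_
    filter_upwards [hpos] with t ht
    have h1 : t - x ≠ 0 := by linarith
    simp only [Pi.sub_apply]
    field_simp
    ring
  have hf0 : 0 ≤ᵐ[τ] fun t => 1 / ((t - x) * (1 + t ^ 2)) := by
    filter_upwards [hpos] with t ht
    have h1 : 0 < t - x := by linarith
    simp only [Pi.zero_apply]
    positivity
  have h1 : ((∫⁻ t, (ENNReal.ofReal ((t - x) * (1 + t ^ 2)))⁻¹ ∂τ : ENNReal) : EReal) =
      ((∫ t, 1 / ((t - x) * (1 + t ^ 2)) ∂τ : ℝ) : EReal) := by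
    have h2 : ∫⁻ t, (ENNReal.ofReal ((t - x) * (1 + t ^ 2)))⁻¹ ∂τ =
        ∫⁻ t, ENNReal.ofReal (1 / ((t - x) * (1 + t ^ 2))) ∂τ := by
      apply lintegral_congr_ae
      filter_upwards [hpos] with t ht
      have h1 : 0 < t - x := by linarith
      rw [one_div, ENNReal.ofReal_inv_of_pos (by positivity)]
    rw [h2, ← ofReal_integral_eq_lintegral_ofReal hfi hf0, EReal.coe_ennreal_ofReal,
      max_eq_left (integral_nonneg_of_ae hf0)]
  simp only [Function.comp_apply]
  rw [h1, ← EReal.coe_add, add_assoc, ← integral_add (hri x hx') hfi]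
  congr 2
  apply integral_congr_ae
  filter_upwards [hpos] with t ht
  have h1 : t - x ≠ 0 := by linarith
  field_simp
  ring

end ValueZero

/-! ### Negative squares of functions with finitely many negative poles -/

namespace PoleRep

variable {n : ℕ} (D : PoleRep n)

theorem ae_nonneg : ∀ᵐ t ∂(D.σ.restrict (Set.Ici 0)), 0 ≤ t :=
  ae_restrict_mem measurableSet_Ici

theorem toFun_eq (z : ℂ) : D.toFun z = (D.b : ℂ) * z + (D.a : ℂ) +
    ∑ j, (D.mass j : ℂ) / ((D.pole j : ℂ) - z) + ∫ t in Set.Ici (0 : ℝ), nevKernel t z ∂D.σ :=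
  rfl

theorem hasValueZeroMinus {Φ : ℂ → ℂ} (hΦ : Set.EqOn Φ D.toFun upperHP) :
    HasValueZeroMinus Φ D.valueZero := by
  let r : ℝ → ℝ := fun x => D.b * x + D.a + ∑ j, D.mass j / (D.pole j - x)
  have hpole : ∀ᶠ x in 𝓝[<] (0 : ℝ), ∀ j, D.pole j < x := by
    rw [eventually_all]
    exact fun j => nhdsWithin_le_nhds (lt_mem_nhds (D.pole_neg j))
  refine ⟨fun x => r x + ∫ t in Set.Ici (0 : ℝ), (1 / (t - x) - t / (1 + t ^ 2)) ∂D.σ, ?_, ?_⟩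
  · filter_upwards [self_mem_nhdsWithin, hpole] with x hx hxp
    have hx' : x < 0 := hx
    have h1 : ContinuousAt (fun y : ℝ => (D.b : ℂ) * (x + y * Complex.I) + (D.a : ℂ) +
        ∑ j, (D.mass j : ℂ) / ((D.pole j : ℂ) - (x + y * Complex.I))) 0 := by
      refine ContinuousAt.add (by fun_prop) (tendsto_finsetSum _ fun j _ => ?_)
      refine ContinuousAt.div (by fun_prop) (by fun_prop) ?_
      simp only [Complex.ofReal_zero, zero_mul, add_zero]
      exact_mod_cast (sub_neg.2 (hxp j)).ne
    have h2 := (h1.tendsto.mono_left (nhdsWithin_le_nhds (s := Set.Ioi 0))).add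
      (tendsto_integral_nevKernel D.σ_integrable D.ae_nonneg hx')
    have h3 : (D.b : ℂ) * (x + (0 : ℝ) * Complex.I) + (D.a : ℂ) +
        ∑ j, (D.mass j : ℂ) / ((D.pole j : ℂ) - (x + (0 : ℝ) * Complex.I)) = (r x : ℂ) := by
      simp [r]
    rw [h3, ← Complex.ofReal_add] at h2
    refine h2.congr' ?_
    filter_upwards [self_mem_nhdsWithin] with y hy
    rw [hΦ (by simpa [upperHP] using hy), toFun_eq]
  · have hr : Tendsto (fun x => r x - (D.a + ∑ j, D.mass j / D.pole j)) (𝓝[<] 0) (𝓝 0) := by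
      have h1 : ContinuousAt (fun x => r x - (D.a + ∑ j, D.mass j / D.pole j)) 0 := by
        refine ContinuousAt.sub (ContinuousAt.add (by fun_prop)
          (tendsto_finsetSum _ fun j _ => ?_)) continuousAt_const
        exact ContinuousAt.div (by fun_prop) (by fun_prop) (by simpa using (D.pole_neg j).ne)
      have h2 := h1.tendsto.mono_left (nhdsWithin_le_nhds (s := Set.Iio 0))
      simpa [r] using h2
    have h1 := tendsto_ereal_integral_nevKernel D.σ_integrable D.ae_nonneg
      (D.a + ∑ j, D.mass j / D.pole j)
    have h2 := (EReal.continuousAt_add (p := ((0 : ℝ), D.valueZero)) (Or.inl (EReal.coe_ne_top 0))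
      (Or.inl (EReal.coe_ne_bot 0))).tendsto.comp ((EReal.tendsto_coe.2 hr).prodMk_nhds h1)
    simp only [EReal.coe_zero, zero_add] at h2
    refine h2.congr fun x => ?_
    simp only [Function.comp_apply]
    rw [← EReal.coe_add]
    congr 1
    ring

/-- The measure of the Nevanlinna representation, including the poles. -/
def totalMeasure : Measure ℝ :=
  D.σ.restrict (Set.Ici 0) + ∑ j, ENNReal.ofReal (D.mass j) • Measure.dirac (D.pole j)

/-- The constant of the Nevanlinna representation. -/
def totalConst : ℝ := D.a + ∑ j, D.mass j * (D.pole j / (1 + D.pole j ^ 2))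

theorem integrable_totalMeasure {E : Type*} [NormedAddCommGroup E] {f : ℝ → E}
    (hf : IntegrableOn f (Set.Ici 0) D.σ) : Integrable f D.totalMeasure := by
  refine Integrable.add_measure hf (integrable_finsetSum_measure.2 fun j _ => ?_)
  exact (integrable_dirac (by simp)).smul_measure ENNReal.ofReal_ne_top

theorem integral_totalMeasure {E : Type*} [NormedAddCommGroup E] [NormedSpace ℝ E]
    [CompleteSpace E] {f : ℝ → E} (hf : IntegrableOn f (Set.Ici 0) D.σ) :
    ∫ t, f t ∂D.totalMeasure =
      ∫ t in Set.Ici 0, f t ∂D.σ + ∑ j, D.mass j • f (D.pole j) := by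
  have hd : ∀ j ∈ Finset.univ, Integrable f
      (ENNReal.ofReal (D.mass j) • Measure.dirac (D.pole j)) := fun j _ =>
    (integrable_dirac (by simp)).smul_measure ENNReal.ofReal_ne_top
  rw [totalMeasure, integral_add_measure hf (integrable_finsetSum_measure.2 hd),
    integral_finsetSum_measure hd]
  congr 1
  refine Finset.sum_congr rfl fun j _ => ?_
  rw [integral_smul_measure, integral_dirac, ENNReal.toReal_ofReal (D.mass_pos j).le]

theorem integrable_one_div_totalMeasure :
    Integrable (fun t : ℝ => 1 / (1 + t ^ 2)) D.totalMeasure :=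
  D.integrable_totalMeasure D.σ_integrable

theorem ae_totalMeasure {P : ℝ → Prop} (h : ∀ᵐ t ∂(D.σ.restrict (Set.Ici 0)), P t)
    (hp : ∀ j, P (D.pole j)) : ∀ᵐ t ∂D.totalMeasure, P t := by
  rw [totalMeasure, ae_add_measure_iff]
  refine ⟨h, ?_⟩
  rw [← Measure.sum_fintype, Measure.ae_sum_iff]
  intro j
  refine Measure.ae_smul_measure ?_ _
  rw [ae_dirac_eq]
  exact hp j

theorem toFun_eqOn : Set.EqOn D.toFun (nevFun D.b D.totalConst D.totalMeasure) upperHP := by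
  intro z hz
  have hz' : z.im ≠ 0 := (show 0 < z.im from hz).ne'
  rw [toFun_eq, nevFun, integral_totalMeasure D (integrable_nevKernel D.σ_integrable hz'),
    totalConst]
  push_cast
  have : ∀ j, D.mass j • nevKernel (D.pole j) z = (D.mass j : ℂ) / ((D.pole j : ℂ) - z) -
      D.mass j * (D.pole j / (1 + (D.pole j : ℂ) ^ 2)) := fun j => by
    rw [Complex.real_smul, nevKernel]
    ring
  simp only [this, Finset.sum_sub_distrib]
  ring

theorem ofReal_mass_le {A : Set ℝ} (j : Fin n) (h : D.pole j ∈ A) :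
    ENNReal.ofReal (D.mass j) ≤ D.totalMeasure A := by
  rw [totalMeasure, Measure.add_apply, Measure.finsetSum_apply]
  refine le_trans ?_ le_add_self
  refine le_trans ?_ (Finset.single_le_sum (fun i _ => zero_le) (Finset.mem_univ j))
  rw [Measure.smul_apply, Measure.dirac_apply_of_mem h]
  simp

/-- From p/(1+p²) + 1/(p+p³) = 1/p: the regularizing constants in `totalConst` and the integral over
the poles recombine into the pole part of `valueZero`. -/
theorem sum_value_eq : ∑ j, D.mass j * (D.pole j / (1 + D.pole j ^ 2)) +
    ∑ j, D.mass j * (1 / (D.pole j + D.pole j ^ 3)) = ∑ j, D.mass j / D.pole j := by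
  rw [← Finset.sum_add_distrib]
  refine Finset.sum_congr rfl fun j _ => ?_
  have h1 := (D.pole_neg j).ne
  have h2 : D.pole j + D.pole j ^ 3 = D.pole j * (1 + D.pole j ^ 2) := by ring
  have h3 : 1 + D.pole j ^ 2 ≠ 0 := by positivity
  rw [h2]
  field_simp
  ring

theorem isGenNevanlinna_of_bounds {Φ : ℂ → ℂ} (hN : IsNevanlinna Φ) {b a : ℝ} {σ : Measure ℝ}
    (hσ : Integrable (fun t : ℝ => 1 / (1 + t ^ 2)) σ)
    (hΦ : Set.EqOn Φ (nevFun b a σ) upperHP) {κ : ℕ}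
    (hle : ∀ (k : ℕ) (z : Fin k → ℂ), (∀ j, (z j).im ≠ 0) →
      negSquares (pickMatrix (fun z => Φ z / z) z) ≤ κ)
    (hge : ∃ (k : ℕ) (z : Fin k → ℂ), Function.Injective z ∧ (∀ j, (z j).im ≠ 0) ∧
      κ ≤ negSquares (pickMatrix (fun z => Φ z / z) z)) :
    IsGenNevanlinna κ (fun z => Φ z / z) := by
  refine ⟨?_, fun k z hz => hle k z fun j => (hz j).1, ?_⟩
  · intro z hz
    have hopen : IsOpen upperHP := isOpen_lt continuous_const Complex.continuous_im
    exact (hN.1.analyticAt (hopen.mem_nhds hz)).meromorphicAt.div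
      analyticAt_id.meromorphicAt
  · obtain ⟨k, z, hinj, hz, h⟩ := hge
    exact ⟨k, z, hinj, isAdmissible_of_nonreal hσ hΦ hz, le_antisymm (hle k z hz) h⟩

theorem isGenNevanlinna_of_valueZero_pos {Φ : ℂ → ℂ} (hN : IsNevanlinna Φ)
    (hΦ : Set.EqOn Φ D.toFun upperHP) (h : 0 < D.valueZero) :
    IsGenNevanlinna (n + 1) (fun z => Φ z / z) := by
  have hΦ' := hΦ.trans D.toFun_eqOn
  have hσ := D.integrable_one_div_totalMeasure
  have hae : ∀ᵐ t ∂D.totalMeasure, 0 ≤ t ∨ ∃ j, t = D.pole j :=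
    D.ae_totalMeasure (D.ae_nonneg.mono fun t ht => Or.inl ht) fun j => Or.inr ⟨j, rfl⟩
  refine isGenNevanlinna_of_bounds hN hσ hΦ'
    (fun k z hz => negSquares_le_add_one hσ hΦ' hae hz) ?_
  have h1 := tendsto_ereal_integral_nevKernel D.σ_integrable D.ae_nonneg
    (D.a + ∑ j, D.mass j / D.pole j)
  -- A finite positive approximation of Φ(0-), taken at s = -x; this also covers the case Φ(0-) = ∞.
  obtain ⟨x, hx, hx0⟩ := ((h1.eventually (lt_mem_nhds h)).and self_mem_nhdsWithin).exists
  have hx0' : x < 0 := hx0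
  have heq : Set.EqOn (valueDensity (-x)) (fun t => 1 / (t - x) - t / (1 + t ^ 2)) (Set.Ici 0) := by
    intro t ht
    simp [valueDensity, not_lt.2 (show (0 : ℝ) ≤ t from ht), ← sub_eq_add_neg]
  have hint : IntegrableOn (valueDensity (-x)) (Set.Ici 0) D.σ :=
    IntegrableOn.congr_fun (integrable_nevKernel_of_neg D.σ_integrable D.ae_nonneg hx0')
      heq.symm measurableSet_Ici
  refine exists_add_one_le_negSquares hσ hΦ' D.pole_injective D.pole_neg (fun i => ?_) hae
    (s := -x) (by linarith) (D.integrable_totalMeasure hint) ?_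
  · have h2 := D.ofReal_mass_le i (Set.mem_singleton _)
    exact ((ENNReal.ofReal_pos.2 (D.mass_pos i)).trans_le h2).ne'
  · rw [D.integral_totalMeasure hint, setIntegral_congr_fun measurableSet_Ici heq, totalConst]
    have h2 : ∀ j, D.mass j • valueDensity (-x) (D.pole j) =
        D.mass j * (1 / (D.pole j + D.pole j ^ 3)) := fun j => by
      rw [valueDensity, if_pos (D.pole_neg j), smul_eq_mul]
    simp only [h2]
    have h3 := D.sum_value_eq
    have h4 : 0 < D.a + ∑ j, D.mass j / D.pole j +
      ∫ t in Set.Ici 0, (1 / (t - x) - t / (1 + t ^ 2)) ∂D.σ := by exact_mod_cast hx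
    linarith

theorem isGenNevanlinna_of_valueZero_nonpos {Φ : ℂ → ℂ} (hN : IsNevanlinna Φ)
    (hΦ : Set.EqOn Φ D.toFun upperHP) (h : D.valueZero ≤ 0) :
    IsGenNevanlinna n (fun z => Φ z / z) := by
  have hΦ' := hΦ.trans D.toFun_eqOn
  have hσ := D.integrable_one_div_totalMeasure
  set L := ∫⁻ t in Set.Ici (0 : ℝ), (ENNReal.ofReal (t + t ^ 3))⁻¹ ∂D.σ with hL
  have hv : D.valueZero = ((D.a + ∑ j, D.mass j / D.pole j : ℝ) : EReal) + (L : EReal) := rfl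
  -- A nonpositive value forces the integral to be finite; as the integrand is infinite at 0, σ then
  -- has no mass there.
  have hLtop : L ≠ ⊤ := by
    intro htop
    rw [hv, htop, EReal.coe_ennreal_top, EReal.coe_add_top] at h
    exact absurd h (not_le.2 EReal.zero_lt_top)
  have hpos : ∀ᵐ t ∂(D.σ.restrict (Set.Ici 0)), 0 < t := by
    have hlt := ae_lt_top (by fun_prop) hLtop
    filter_upwards [hlt] with t ht
    rw [ENNReal.inv_lt_top, ENNReal.ofReal_pos] at ht
    by_contra hcon
    have h1 : t ≤ 0 := not_lt.1 hcon
    nlinarith [mul_nonpos_of_nonpos_of_nonneg h1 (sq_nonneg t)]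
  have hnn : 0 ≤ᵐ[D.σ.restrict (Set.Ici 0)] fun t : ℝ => 1 / (t + t ^ 3) := by
    filter_upwards [hpos] with t ht
    simp only [Pi.zero_apply]
    positivity
  have hL' : ∫⁻ t in Set.Ici (0 : ℝ), ENNReal.ofReal (1 / (t + t ^ 3)) ∂D.σ = L := by
    apply lintegral_congr_ae
    filter_upwards [hpos] with t ht
    rw [one_div, ENNReal.ofReal_inv_of_pos (by positivity)]
  have hint : IntegrableOn (fun t : ℝ => 1 / (t + t ^ 3)) (Set.Ici 0) D.σ := by
    refine ⟨(by fun_prop : Measurable _).aestronglyMeasurable, ?_⟩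
    rw [hasFiniteIntegral_iff_ofReal hnn, hL']
    exact hLtop.lt_top
  have hval : D.a + ∑ j, D.mass j / D.pole j + L.toReal ≤ 0 := by
    rw [hv, ← EReal.coe_ennreal_toReal hLtop] at h
    exact_mod_cast h
  refine isGenNevanlinna_of_bounds hN hσ hΦ' (fun k z hz => ?_) ?_
  · refine negSquares_le_of_value_nonpos hσ hΦ' (fun j => (D.pole_neg j).ne)
      (D.ae_totalMeasure (hpos.mono fun t ht => Or.inl ht) fun j => Or.inr ⟨j, rfl⟩)
      (D.integrable_totalMeasure hint) ?_ hz
    rw [D.integral_totalMeasure hint, totalConst, integral_eq_lintegral_of_nonneg_ae hnn hint.1,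
      hL']
    have h3 := D.sum_value_eq
    simp only [smul_eq_mul]
    linarith
  · refine exists_le_negSquares_of_lowerDensity hσ hΦ' D.pole_injective D.pole_neg fun i => ?_
    refine ⟨D.mass i, D.mass_pos i, ?_⟩
    -- For r ≤ 1 a point mass m is at least m * r, so every pole has positive lower density.
    filter_upwards [Ioc_mem_nhdsGT one_pos] with r hr
    refine le_trans (ENNReal.ofReal_le_ofReal ?_)
      (D.ofReal_mass_le i (Metric.mem_closedBall_self hr.1.le))
    nlinarith [hr.2, D.mass_pos i]

end PoleRep

/-! ### Finiteness of the negative part of the measure -/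

/-- Lebesgue measure is differentiated with respect to σ, not the reverse: the derivative is finite
σ-almost everywhere, so 2r ≤ Q σ(B(x, r)) for small r with some finite Q. -/
theorem ae_hasPositiveLowerDensity {σ : Measure ℝ}
    (hσ : Integrable (fun t : ℝ => 1 / (1 + t ^ 2)) σ) :
    ∀ᵐ x ∂σ, HasPositiveLowerDensity σ x := by
  have hloc : IsLocallyFiniteMeasure σ :=
    ⟨fun x => ⟨Metric.closedBall x 1, Metric.closedBall_mem_nhds x one_pos,
      measure_closedBall_lt_top hσ x 1⟩⟩
  filter_upwards [Besicovitch.ae_tendsto_rnDeriv (volume : Measure ℝ) σ,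
    Measure.rnDeriv_lt_top (volume : Measure ℝ) σ] with x hx hlt
  obtain ⟨Q, hQ1, hQ2⟩ := ENNReal.lt_iff_exists_nnreal_btwn.1 hlt
  have hQ0 : 0 < Q := by
    rw [← ENNReal.coe_pos]
    exact hQ1.bot_lt
  refine ⟨2 / Q, by positivity, ?_⟩
  filter_upwards [hx.eventually (gt_mem_nhds hQ1), self_mem_nhdsWithin] with r hr hr0
  have hr0' : 0 < r := hr0
  rw [Real.volume_closedBall] at hr
  have h1 : ENNReal.ofReal (2 * r) ≤ Q * σ (Metric.closedBall x r) := by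
    refine (ENNReal.div_le_iff_le_mul ?_ (Or.inl (measure_closedBall_lt_top hσ x r).ne)).1 hr.le
    exact Or.inr (by simp)
  have h2 : ENNReal.ofReal (2 / Q * r) = ENNReal.ofReal (2 * r) / Q := by
    rw [div_mul_eq_mul_div, ENNReal.ofReal_div_of_pos (by exact_mod_cast hQ0),
      ENNReal.ofReal_coe_nnreal]
  rw [h2]
  exact ENNReal.div_le_of_le_mul' h1

theorem exists_poleRep {Φ : ℂ → ℂ} {b a : ℝ} {σ : Measure ℝ} (hb : 0 ≤ b)
    (hσ : Integrable (fun t : ℝ => 1 / (1 + t ^ 2)) σ)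
    (hΦ : Set.EqOn Φ (nevFun b a σ) upperHP) {S : Finset ℝ} (hS : ∀ x ∈ S, x < 0)
    (hae : ∀ᵐ t ∂σ, t < 0 → t ∈ S) :
    ∃ (n : ℕ) (D : PoleRep n), Set.EqOn Φ D.toFun upperHP := by
  classical
  -- Points of S without mass are discarded because the masses of a `PoleRep` must be positive.
  let Λ := S.filter fun x => σ {x} ≠ 0
  have hΛae : ∀ᵐ t ∂σ, t < 0 → t ∈ Λ := by
    have h1 : ∀ᵐ t ∂σ, ∀ x ∈ S, σ {x} = 0 → t ≠ x := by
      rw [Filter.eventually_all_finset]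
      intro x _
      by_cases h : σ {x} = 0
      · have : ∀ᵐ t ∂σ, t ≠ x := by
          rw [ae_iff]
          simpa using h
        filter_upwards [this] with t ht _ using ht
      · exact Eventually.of_forall fun t h' => absurd h' h
    filter_upwards [hae, h1] with t h2 h3 ht
    exact Finset.mem_filter.2 ⟨h2 ht, fun h => h3 t (h2 ht) h rfl⟩
  have hΛneg : ∀ x ∈ Λ, x < 0 := fun x hx => hS x (Finset.mem_filter.1 hx).1
  have hfin : ∀ x, σ {x} ≠ ⊤ := fun x => by
    have := (measure_closedBall_lt_top hσ x 0).ne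
    rwa [Metric.closedBall_zero] at this
  let p : Fin Λ.card → ℝ := fun j => Λ.equivFin.symm j
  have hpmem : ∀ j, p j ∈ Λ := fun j => (Λ.equivFin.symm j).2
  let D : PoleRep Λ.card :=
    { b := b
      a := a - ∑ j, σ.real {p j} * (p j / (1 + p j ^ 2))
      pole := p
      mass := fun j => σ.real {p j}
      σ := σ.restrict (Set.Ici 0)
      b_nonneg := hb
      pole_neg := fun j => hΛneg _ (hpmem j)
      pole_injective := Subtype.val_injective.comp Λ.equivFin.symm.injective
      mass_pos := fun j => ENNReal.toReal_pos (Finset.mem_filter.1 (hpmem j)).2 (hfin _)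
      σ_neg := by
        rw [Measure.restrict_apply measurableSet_Iio]
        have : Set.Iio (0 : ℝ) ∩ Set.Ici 0 = ∅ := by
          ext x
          simp
        rw [this, measure_empty]
      σ_integrable := hσ.restrict.restrict }
  refine ⟨Λ.card, D, hΦ.trans fun z hz => ?_⟩
  rw [D.toFun_eqOn hz]
  have h1 : D.totalConst = a := sub_add_cancel _ _
  have h2 : D.totalMeasure = σ := by
    ext A hA
    rw [PoleRep.totalMeasure, Measure.add_apply, Measure.finsetSum_apply]
    change (σ.restrict (Set.Ici 0)).restrict (Set.Ici 0) A + ∑ j,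
      (ENNReal.ofReal (σ.real {p j}) • Measure.dirac (p j)) A = σ A
    have h3 : ∑ j, (ENNReal.ofReal (σ.real {p j}) • Measure.dirac (p j)) A =
        σ (A \ Set.Ici 0) := by
      have h4 : ∀ j, (ENNReal.ofReal (σ.real {p j}) • Measure.dirac (p j)) A =
          if p j ∈ A then σ {p j} else 0 := fun j => by
        rw [Measure.smul_apply, Measure.dirac_apply' _ hA, Measure.real,
          ENNReal.ofReal_toReal (hfin _)]
        by_cases h : p j ∈ A <;> simp [h]
      simp only [h4]
      have h5 : ∑ j, (if p j ∈ A then σ {p j} else 0) =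
          ∑ x ∈ Λ, if x ∈ A then σ {x} else 0 := by
        rw [← Finset.sum_coe_sort Λ]
        exact Fintype.sum_equiv Λ.equivFin.symm _ _ fun j => rfl
      rw [h5, ← Finset.sum_filter, sum_measure_singleton]
      apply measure_congr
      filter_upwards [hΛae] with t ht
      apply propext
      change t ∈ ((Λ.filter fun x => x ∈ A : Finset ℝ) : Set ℝ) ↔ t ∈ A \ Set.Ici 0
      rw [Finset.mem_coe, Finset.mem_filter, Set.mem_sdiff, Set.mem_Ici, not_le]
      exact ⟨fun h => ⟨h.2, hΛneg t h.1⟩, fun h => ⟨ht h.2, h.1⟩⟩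
    rw [h3, Measure.restrict_restrict measurableSet_Ici, Set.inter_self,
      Measure.restrict_apply hA, measure_inter_add_sdiff A measurableSet_Ici]
  rw [h1, h2]

theorem IsGenNevanlinna.unique {κ κ' : ℕ} {φ : ℂ → ℂ} (h : IsGenNevanlinna κ φ)
    (h' : IsGenNevanlinna κ' φ) : κ = κ' := by
  obtain ⟨-, hle, k, z, -, hz, heq⟩ := h
  obtain ⟨-, hle', k', z', -, hz', heq'⟩ := h'
  exact le_antisymm (heq ▸ hle' k z hz) (heq' ▸ hle k' z' hz')

/-- κ + 1 negative points of positive lower density would give a form with more than κ negative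
squares, so there are finitely many; these points carry σ on the negative half-line. -/
theorem IsGenNevanlinna.exists_poleRep {Φ : ℂ → ℂ} (hN : IsNevanlinna Φ) {κ : ℕ}
    (h : IsGenNevanlinna κ (fun z => Φ z / z)) :
    ∃ (n : ℕ) (D : PoleRep n), Set.EqOn Φ D.toFun upperHP := by
  obtain ⟨b, a, σ, hb, hσ, hΦ⟩ := hN.exists_nevFun
  let G : Set ℝ := {x | x < 0 ∧ HasPositiveLowerDensity σ x}
  have hG : G.Finite := by
    by_contra hinf
    obtain ⟨s, hs, hcard⟩ := Set.Infinite.exists_subset_card_eq hinf (κ + 1)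
    have hmem : ∀ j : Fin s.card, (s.equivFin.symm j : ℝ) ∈ G := fun j =>
      hs (s.equivFin.symm j).2
    obtain ⟨k, z, -, hz, hle⟩ := exists_le_negSquares_of_lowerDensity hσ hΦ
      (x := fun j : Fin s.card => (s.equivFin.symm j : ℝ))
      (Subtype.val_injective.comp s.equivFin.symm.injective)
      (fun j => (hmem j).1) (fun j => (hmem j).2)
    have := h.2.1 k z (isAdmissible_of_nonreal hσ hΦ hz)
    omega
  refine _root_.exists_poleRep hb hσ hΦ (S := hG.toFinset)
    (fun x hx => ((hG.mem_toFinset).1 hx).1) ?_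
  filter_upwards [ae_hasPositiveLowerDensity hσ] with t ht ht0
  exact hG.mem_toFinset.2 ⟨ht0, ht⟩

end

/-! ### The characterization -/

theorem theorem1 (Φ : ℂ → ℂ) (hΦ : IsNevanlinna Φ) (κ : ℕ) :
    (IsGenNevanlinna κ (fun z => Φ z / z) ↔
      (∃ n : ℕ, n + 1 = κ ∧
        ∃ D : PoleRep n, Set.EqOn Φ D.toFun upperHP ∧ 0 < D.valueZero) ∨
      (∃ D : PoleRep κ, Set.EqOn Φ D.toFun upperHP ∧ D.valueZero ≤ 0)) ∧
    (IsGenNevanlinna κ (fun z => Φ z / z) ↔ IsGenNevanlinnaPlus κ (fun z => Φ z / z)) ∧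
    (∀ (n : ℕ) (D : PoleRep n), Set.EqOn Φ D.toFun upperHP →
      HasValueZeroMinus Φ D.valueZero) := by
  refine ⟨⟨fun h => ?_, ?_⟩, ⟨fun h => ⟨h, ?_⟩, fun h => h.1⟩,
    fun n D hD => D.hasValueZeroMinus hD⟩
  · obtain ⟨n, D, hD⟩ := h.exists_poleRep hΦ
    -- The two signs are exhaustive and each determines the index from n, so uniqueness of the index
    -- yields the converse.
    rcases lt_or_ge 0 D.valueZero with hv | hv
    · exact Or.inl ⟨n, (D.isGenNevanlinna_of_valueZero_pos hΦ hD hv).unique h, D, hD, hv⟩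
    · obtain rfl := (D.isGenNevanlinna_of_valueZero_nonpos hΦ hD hv).unique h
      exact Or.inr ⟨D, hD, hv⟩
  · rintro (⟨n, rfl, D, hD, hv⟩ | ⟨D, hD, hv⟩)
    · exact D.isGenNevanlinna_of_valueZero_pos hΦ hD hv
    · exact D.isGenNevanlinna_of_valueZero_nonpos hΦ hD hv
  · have heq : Set.EqOn (fun z => z * (Φ z / z)) Φ upperHP := by
      intro z hz
      have hz0 : z ≠ 0 := by
        rintro rfl
        simp [upperHP] at hz
      exact mul_div_cancel₀ _ hz0
    exact ⟨hΦ.1.congr heq, fun z hz => (congrArg Complex.im (heq hz)).symm ▸ hΦ.2 z hz⟩
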